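/- Let $n\ge 1$ and let $K\subset\mathbb R^n$ be a convex body (a nonempty compact convex set) that contains $n+1$ affinely independent points of the integral lattice $\mathbb Z^n$. Then $$\#(K\cap\mathbb Z^n)<\mathrm{vol}(K)+\frac{\sqrt n+1}{2}\,(n-1)!\,\mathrm F(K),$$ where $\mathrm{vol}(K)$ is the $n$-dimensional Lebesgue measure of $K$ and $\mathrm F(K)$ is its surface area, i.e. the $(n-1)$-dimensional Hausdorff measure of the boundary of $K$, normalized so that it agrees with Lebesgue measure on $\mathbb R^{n-1}$ (for $n=1$ it is the counting measure). -/

import Mathlib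

open MeasureTheory

/-- The integral lattice `ℤⁿ`, as a subset of Euclidean `n`-space. -/
def integerLattice (n : ℕ) : Set (EuclideanSpace ℝ (Fin n)) :=
  {x | ∀ i, ∃ k : ℤ, x i = (k : ℝ)}

/-- The lattice point enumerator `G(S) = #(S ∩ ℤⁿ)`. (For bounded `S` the set is finite.) -/
noncomputable def latticePointCount {n : ℕ} (S : Set (EuclideanSpace ℝ (Fin n))) : ℕ :=
  (S ∩ integerLattice n).ncard

/-- The surface area `F(K)` of a convex body with nonempty interior in Euclidean `n`-space, `n ≥ 1`:
the `(n-1)`-dimensional Hausdorff measure of the topological boundary of `K`, where the Hausdorff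
measure is normalized so that it is Lebesgue measure on Euclidean `(n-1)`-space
(counting measure for `n = 1`). -/
noncomputable def surfaceArea {n : ℕ} (K : ConvexBody (EuclideanSpace ℝ (Fin n))) : ℝ :=
  (Measure.euclideanHausdorffMeasure (n - 1) : Measure (EuclideanSpace ℝ (Fin n))).real
    (frontier (K : Set (EuclideanSpace ℝ (Fin n))))

/-! Let P be the convex hull of the lattice points of K. It has the same lattice points as K, its
volume is no larger, and neither is its surface area, because nearest-point projection does not
increase area (`euclideanHausdorffMeasure_frontier_mono`). A regular triangulation cuts the boundary
of P into simplices whose vertices are vertices of P. Let T be the sum of their weights, a weight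
being (n-1)! times an area; then T ≤ (n-1)! F(K) by `sum_facetWeight_le`.

Translate the lattice points of P by a random vector c of the centred unit cube. Cubes around
distinct lattice points are disjoint, so on average at most vol(P) points stay in P
(`card_le_volume_add`). A point that leaves either starts on a facet or crosses one at a time
strictly between 0 and 1.

At most T points start on a facet (`card_boundary_le`). A facet carries at most its weight minus one
lattice points besides its vertices, and there are no more vertices than facets, since each vertex
lies on at least n facets and each facet has n vertices.

For generic c, at most |det(c, edges)| points cross a given facet (`card_sweep_le`): they lie in
parallel lattice layers, each holding a bounded number of them. Only facets crossed outwards matter,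
which halves the mean of the determinant to at most √n/8 times the weight
(`integral_halfspace_abs_le`).

For n ≥ 2 the count is thus at most vol(P) + (1 + √n/8) T, and 1 + √n/8 < (√n + 1)/2 because √n >
4/3. For n = 1 at most one point leaves, while T ≥ 2. -/

/-! ### Regular triangulations through weights of least cost -/

section Triangulation

variable {ι E : Type*} [Fintype ι] [AddCommGroup E] [Module ℝ E]

/-- The point with weights `l` with respect to the family `a`. -/
def bary (a : ι → E) : (ι → ℝ) →ₗ[ℝ] E := Fintype.linearCombination ℝ a

theorem bary_apply (a : ι → E) (l : ι → ℝ) : bary a l = ∑ i, l i • a i := rfl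

/-- The convex weights that vanish off `s`. -/
def faceWeights (s : Finset ι) : Set (ι → ℝ) := {l | l ∈ stdSimplex ℝ ι ∧ ∀ i ∉ s, l i = 0}

/-- The convex hull of the points of the family `a` with indices in `s`. -/
def cell (a : ι → E) (s : Finset ι) : Set E := bary a '' faceWeights s

/-- Affine independence of the points with indices in `s`, stated through weights. -/
def AffIndepOn (a : ι → E) (s : Finset ι) : Prop :=
  ∀ v : ι → ℝ, (∀ i ∉ s, v i = 0) → ∑ i, v i = 0 → bary a v = 0 → v = 0

/-- The cost of weights for the heights `h`. -/
def cost (h : ι → ℝ) (l : ι → ℝ) : ℝ := ∑ i, l i * h i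

theorem cost_add (h l m : ι → ℝ) : cost h (l + m) = cost h l + cost h m := by
  simp [cost, add_mul, Finset.sum_add_distrib]

theorem cost_smul (h l : ι → ℝ) (t : ℝ) : cost h (t • l) = t * cost h l := by
  simp [cost, Finset.mul_sum, mul_assoc]

/-- Heights such that no affinely dependent subfamily has its dependencies killed by them. -/
def GenericHeights (a : ι → E) (h : ι → ℝ) : Prop :=
  ∀ s : Finset ι, ¬ AffIndepOn a s →
    ∃ v : ι → ℝ, (∀ i ∉ s, v i = 0) ∧ ∑ i, v i = 0 ∧ bary a v = 0 ∧ cost h v ≠ 0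

/-- Weights of least cost among all the convex weights that represent the same point. -/
def IsOpt (a : ι → E) (h l : ι → ℝ) : Prop :=
  l ∈ stdSimplex ℝ ι ∧ ∀ m ∈ stdSimplex ℝ ι, bary a m = bary a l → cost h l ≤ cost h m

/-- For one chosen nonzero dependency of each dependent subfamily, the heights that kill it form a
proper subspace, and a real vector space is not a finite union of proper subspaces. -/
theorem exists_genericHeights (a : ι → E) : ∃ h, GenericHeights a h := by
  classical
  have key : ∀ s : Finset ι, ∃ v : ι → ℝ, ¬ AffIndepOn a s →
      (∀ i ∉ s, v i = 0) ∧ ∑ i, v i = 0 ∧ bary a v = 0 ∧ v ≠ 0 := by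
    intro s
    by_cases hs : AffIndepOn a s
    · exact ⟨0, fun h => absurd hs h⟩
    · unfold AffIndepOn at hs
      push Not at hs
      obtain ⟨v, h1, h2, h3, h4⟩ := hs
      exact ⟨v, fun _ => ⟨h1, h2, h3, h4⟩⟩
  choose v hv using key
  let p : {s : Finset ι // ¬ AffIndepOn a s} → Subspace ℝ (ι → ℝ) := fun s =>
    LinearMap.ker (Fintype.linearCombination ℝ (v s.1))
  by_contra hcon
  push Not at hcon
  have hcov : ⋃ i, (p i : Set (ι → ℝ)) = Set.univ := by
    refine Set.eq_univ_of_forall fun h => ?_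
    have := hcon h
    unfold GenericHeights at this
    push Not at this
    obtain ⟨s, hs, hs2⟩ := this
    refine Set.mem_iUnion.2 ⟨⟨s, hs⟩, ?_⟩
    obtain ⟨h1, h2, h3, h4⟩ := hv s hs
    have := hs2 (v s) h1 h2 h3
    simp only [p, SetLike.mem_coe, LinearMap.mem_ker, Fintype.linearCombination_apply, smul_eq_mul]
    rw [← this, cost]
    exact Finset.sum_congr rfl fun i _ => mul_comm _ _
  obtain ⟨⟨s, hs⟩, h⟩ := Subspace.exists_eq_top_of_iUnion_eq_univ hcov
  obtain ⟨h1, h2, h3, h4⟩ := hv s hs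
  apply h4
  funext i
  have : (Pi.single i 1 : ι → ℝ) ∈ p ⟨s, hs⟩ := by rw [h]; trivial
  simpa [p] using this

theorem IsOpt.affIndepOn {a : ι → E} {h l : ι → ℝ} (hg : GenericHeights a h) (hl : IsOpt a h l)
    {s : Finset ι} (hs : ∀ i ∈ s, l i ≠ 0) : AffIndepOn a s := by
  by_contra hcon
  obtain ⟨v, h1, h2, h3, h4⟩ := hg s hcon
  have hpos : ∀ i ∈ s, 0 < l i := fun i hi => lt_of_le_of_ne (hl.1.1 i) (hs i hi).symm
  -- a small perturbation of `l` along any dependency stays in the simplex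
  have pert : ∀ w : ι → ℝ, (∀ i ∉ s, w i = 0) → ∑ i, w i = 0 → bary a w = 0 → 0 ≤ cost h w := by
    intro w w1 w2 w3
    obtain ⟨e, he, hle⟩ : ∃ e : ℝ, 0 < e ∧ ∀ i, 0 ≤ l i + e * w i := by
      have : ∀ i, ∀ᶠ e in nhdsWithin (0 : ℝ) (Set.Ioi 0), 0 ≤ l i + e * w i := by
        intro i
        by_cases hi : i ∈ s
        · have hc : Filter.Tendsto (fun e : ℝ => l i + e * w i) (nhds 0) (nhds (l i + 0 * w i)) :=
            Continuous.tendsto (by fun_prop) 0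
          have hp : 0 < l i + 0 * w i := by simpa using hpos i hi
          exact ((hc.eventually (lt_mem_nhds hp)).filter_mono nhdsWithin_le_nhds).mono
            fun e he => he.le
        · exact Filter.Eventually.of_forall fun e => by simpa [w1 i hi] using hl.1.1 i
      obtain ⟨e, he⟩ := ((Filter.eventually_all.2 this).and self_mem_nhdsWithin).exists
      exact ⟨e, he.2, he.1⟩
    have hm : l + e • w ∈ stdSimplex ℝ ι := by
      refine ⟨fun i => by simpa using hle i, ?_⟩
      simp [Finset.sum_add_distrib, ← Finset.mul_sum, w2, hl.1.2]
    have := hl.2 _ hm (by simp [w3])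
    rw [cost_add, cost_smul] at this
    nlinarith
  have a1 := pert v h1 h2 h3
  have a2 := pert (-v) (fun i hi => by simp [h1 i hi]) (by simp [h2]) (by simp [h3])
  have a3 : cost h (-v) = - cost h v := by simp [cost]
  exact h4 (by linarith)

/-- Optimality depends only on the support. If `m'` represented the same point as `m` at lower cost,
a small step of `l` along `m' - m` would lower the cost of `l`; the step stays in the simplex
because `l` is positive wherever `m` is. -/
theorem IsOpt.of_support {a : ι → E} {h l m : ι → ℝ} (hl : IsOpt a h l)
    (hm : m ∈ stdSimplex ℝ ι) (hs : ∀ i, l i = 0 → m i = 0) : IsOpt a h m := by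
  refine ⟨hm, fun m' hm' hb => ?_⟩
  obtain ⟨e, he, hle⟩ : ∃ e : ℝ, 0 < e ∧ ∀ i, 0 ≤ l i + e * (m' i - m i) := by
    have : ∀ i, ∀ᶠ e in nhdsWithin (0 : ℝ) (Set.Ioi 0), 0 ≤ l i + e * (m' i - m i) := by
      intro i
      by_cases hi : l i = 0
      · filter_upwards [self_mem_nhdsWithin] with e he
        rw [hi, hs i hi]
        have := mul_nonneg (le_of_lt he) (hm'.1 i)
        simpa using this
      · have hc : Filter.Tendsto (fun e : ℝ => l i + e * (m' i - m i)) (nhds 0)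
            (nhds (l i + 0 * (m' i - m i))) := Continuous.tendsto (by fun_prop) 0
        have hp : 0 < l i + 0 * (m' i - m i) := by
          simpa using lt_of_le_of_ne (hl.1.1 i) (Ne.symm hi)
        exact ((hc.eventually (lt_mem_nhds hp)).filter_mono nhdsWithin_le_nhds).mono
          fun e he => he.le
    obtain ⟨e, he⟩ := ((Filter.eventually_all.2 this).and self_mem_nhdsWithin).exists
    exact ⟨e, he.2, he.1⟩
  have hmem : l + e • (m' + (-1 : ℝ) • m) ∈ stdSimplex ℝ ι := by
    refine ⟨fun i => by simpa [mul_sub, sub_eq_add_neg, mul_add] using hle i, ?_⟩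
    simp [Finset.sum_add_distrib, ← Finset.mul_sum, hm.2, hm'.2, hl.1.2]
  have := hl.2 _ hmem (by simp [hb])
  rw [cost_add, cost_smul, cost_add, cost_smul] at this
  nlinarith

/-- The midpoint of `l` and `m` is again optimal, so its support is affinely independent. That
support contains both others, hence the dependency `l - m` lives on it and vanishes. -/
theorem IsOpt.unique {a : ι → E} {h l m : ι → ℝ} (hg : GenericHeights a h) (hl : IsOpt a h l)
    (hm : IsOpt a h m) (hb : bary a l = bary a m) : l = m := by
  classical
  have hc : cost h l = cost h m := le_antisymm (hl.2 m hm.1 hb.symm) (hm.2 l hl.1 hb)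
  have hmid : (1 / 2 : ℝ) • l + (1 / 2 : ℝ) • m ∈ stdSimplex ℝ ι :=
    convex_stdSimplex ℝ ι hl.1 hm.1 (by norm_num) (by norm_num) (by norm_num)
  have hbm : bary a ((1 / 2 : ℝ) • l + (1 / 2 : ℝ) • m) = bary a l := by
    rw [map_add, map_smul, map_smul, ← hb, ← add_smul]; norm_num
  have hopt : IsOpt a h ((1 / 2 : ℝ) • l + (1 / 2 : ℝ) • m) := by
    refine ⟨hmid, fun m' hm' hb' => ?_⟩
    have := hl.2 m' hm' (hb'.trans hbm)
    rw [cost_add, cost_smul, cost_smul, ← hc]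
    linarith
  have hind := hopt.affIndepOn hg
    (s := Finset.univ.filter fun i => ((1 / 2 : ℝ) • l + (1 / 2 : ℝ) • m) i ≠ 0)
    (fun i hi => (Finset.mem_filter.1 hi).2)
  have := hind (l - m) ?_ (by simp [hl.1.2, hm.1.2]) (by simp [hb])
  · exact sub_eq_zero.1 this
  · intro i hi
    have hi' : ((1 / 2 : ℝ) • l + (1 / 2 : ℝ) • m) i = 0 := by simpa using hi
    simp only [Pi.add_apply, Pi.smul_apply, smul_eq_mul] at hi'
    have p1 := hl.1.1 i
    have p2 := hm.1.1 i
    simp only [Pi.sub_apply]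
    linarith

theorem convex_faceWeights (s : Finset ι) : Convex ℝ (faceWeights s) := by
  intro l hl m hm p q hp hq hpq
  exact ⟨convex_stdSimplex ℝ ι hl.1 hm.1 hp hq hpq, fun i hi => by simp [hl.2 i hi, hm.2 i hi]⟩

theorem isCompact_faceWeights (s : Finset ι) : IsCompact (faceWeights s) := by
  refine (isCompact_stdSimplex ℝ ι).of_isClosed_subset ?_ fun l hl => hl.1
  have : faceWeights s = stdSimplex ℝ ι ∩ ⋂ i ∈ ((s : Set ι)ᶜ), {l : ι → ℝ | l i = 0} := by
    ext l; simp [faceWeights]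
  rw [this]
  exact (isClosed_stdSimplex ℝ ι).inter
    (isClosed_biInter fun i _ => isClosed_eq (continuous_apply i) continuous_const)

theorem cell_mono {a : ι → E} {s t : Finset ι} (h : s ⊆ t) : cell a s ⊆ cell a t := by
  rintro _ ⟨l, hl, rfl⟩
  exact ⟨l, ⟨hl.1, fun i hi => hl.2 i fun h' => hi (h h')⟩, rfl⟩

theorem convex_cell (a : ι → E) (s : Finset ι) : Convex ℝ (cell a s) :=
  (convex_faceWeights s).linear_image _

theorem mem_cell_of_mem (a : ι → E) {s : Finset ι} {i : ι} (hi : i ∈ s) : a i ∈ cell a s := by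
  classical
  refine ⟨Pi.single i 1, ⟨single_mem_stdSimplex ℝ i, fun j hj => ?_⟩, by simp [bary]⟩
  rw [Pi.single_eq_of_ne]
  rintro rfl
  exact hj hi

theorem cell_subset_of_convex {a : ι → E} {s : Finset ι} {C : Set E} (hC : Convex ℝ C)
    (h : ∀ i ∈ s, a i ∈ C) : cell a s ⊆ C := by
  classical
  rintro _ ⟨l, ⟨hl, hs⟩, rfl⟩
  have e : ∑ i ∈ s, l i = 1 := by
    rw [← hl.2]; exact Finset.sum_subset (Finset.subset_univ _) fun i _ hi => hs i hi
  have : bary a l = ∑ i ∈ s, l i • a i := by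
    rw [bary_apply]
    exact (Finset.sum_subset (Finset.subset_univ _) fun i _ hi => by simp [hs i hi]).symm
  rw [this]
  exact hC.sum_mem (fun i _ => hl.1 i) e h

theorem cell_eq_convexHull (a : ι → E) (s : Finset ι) :
    cell a s = convexHull ℝ (a '' s) := by
  apply Set.Subset.antisymm
  · exact cell_subset_of_convex (convex_convexHull ℝ _) fun i hi =>
      subset_convexHull ℝ _ (Set.mem_image_of_mem a hi)
  · exact convexHull_min (by rintro _ ⟨i, hi, rfl⟩; exact mem_cell_of_mem a hi) (convex_cell _ _)

/-- Every weight vector supported on `s` is optimal: `s` is a face of the regular triangulation. -/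
def OptFace (a : ι → E) (h : ι → ℝ) (s : Finset ι) : Prop := ∀ l ∈ faceWeights s, IsOpt a h l

/-- A common point has only one optimal weight vector, which is therefore supported on both faces.
This makes distinct facets overlap in a null set. -/
theorem cell_inter_subset [DecidableEq ι] {a : ι → E} {h : ι → ℝ} (hg : GenericHeights a h)
    {s t : Finset ι} (hs : OptFace a h s) (ht : OptFace a h t) :
    cell a s ∩ cell a t ⊆ cell a (s ∩ t) := by
  rintro x ⟨⟨l, hl, rfl⟩, ⟨m, hm, hb⟩⟩
  obtain rfl := (hs l hl).unique hg (ht m hm) hb.symm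
  refine ⟨l, ⟨hl.1, fun i hi => ?_⟩, rfl⟩
  by_cases h1 : i ∈ s
  · exact hm.2 i fun h2 => hi (Finset.mem_inter.2 ⟨h1, h2⟩)
  · exact hl.2 i h1

end Triangulation

/-! ### Compactness: the cells cover the polytope -/

section TriangulationTop

variable {ι E : Type*} [Fintype ι] [NormedAddCommGroup E] [NormedSpace ℝ E]

theorem continuous_bary (a : ι → E) : Continuous (bary a) := by
  simp only [funext (bary_apply a)]; fun_prop

theorem isCompact_cell (a : ι → E) (s : Finset ι) : IsCompact (cell a s) :=
  (isCompact_faceWeights s).image (continuous_bary a)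

theorem exists_isOpt (a : ι → E) (h : ι → ℝ) {x : E} (hx : x ∈ cell a Finset.univ) :
    ∃ l, IsOpt a h l ∧ bary a l = x := by
  have hcomp : IsCompact {l | l ∈ stdSimplex ℝ ι ∧ bary a l = x} :=
    (isCompact_stdSimplex ℝ ι).inter_right (isClosed_eq (continuous_bary a) continuous_const)
  obtain ⟨l0, hl0, hl0x⟩ := hx
  obtain ⟨l, hl, hmin⟩ := hcomp.exists_isMinOn (f := cost h) ⟨l0, hl0.1, hl0x⟩
    (Continuous.continuousOn (by unfold cost; fun_prop))
  exact ⟨l, ⟨hl.1, fun m hm hb => hmin ⟨hm, hb.trans hl.2⟩⟩, hl.2⟩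

/-- A point of the convex hull lies in a cell of the regular triangulation, with positive
weights at all its vertices. -/
theorem exists_optFace {a : ι → E} {h : ι → ℝ} (hg : GenericHeights a h) {x : E}
    (hx : x ∈ cell a Finset.univ) :
    ∃ s : Finset ι, OptFace a h s ∧ AffIndepOn a s ∧
      ∃ l ∈ faceWeights s, (∀ i ∈ s, 0 < l i) ∧ bary a l = x := by
  classical
  obtain ⟨l, hl, hlx⟩ := exists_isOpt a h hx
  refine ⟨Finset.univ.filter fun i => l i ≠ 0, ?_, hl.affIndepOn hg (by simp), l,
    ⟨hl.1, by simp⟩, ?_, hlx⟩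
  · intro m hm
    exact hl.of_support hm.1 fun i hi => hm.2 i (by simpa using hi)
  · intro i hi
    exact lt_of_le_of_ne (hl.1.1 i) (Ne.symm (Finset.mem_filter.1 hi).2)

end TriangulationTop

/-! ### Boundary facets, and how directions leave through them -/

section Facets

variable {ι E : Type*} [Fintype ι] [NormedAddCommGroup E] [NormedSpace ℝ E]

/-- The functional `f` attains its maximum over the polytope `cell a univ` at all points of
`cell a s`, and at no interior point. -/
def Supports (a : ι → E) (s : Finset ι) (f : E →L[ℝ] ℝ) : Prop :=
  (∀ x ∈ cell a Finset.univ, ∀ y ∈ cell a s, f x ≤ f y) ∧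
    ∀ x ∈ interior (cell a Finset.univ), ∀ y ∈ cell a s, f x < f y

/-- The cells of top dimension in the triangulation of the boundary. -/
structure IsFacet (a : ι → E) (h : ι → ℝ) (s : Finset ι) : Prop where
  opt : OptFace a h s
  indep : AffIndepOn a s
  card : s.card = Module.finrank ℝ E
  supp : ∃ f, Supports a s f

/-- A hyperplane that supports the polytope at a point with positive weights on `s` contains every
vertex of `s`: an average of values equals their upper bound only if all of them do. -/
theorem exists_supports {a : ι → E} (hint : (interior (cell a Finset.univ)).Nonempty)
    {s : Finset ι} {l : ι → ℝ} (hl : l ∈ faceWeights s) (hpos : ∀ i ∈ s, 0 < l i)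
    (hb : bary a l ∉ interior (cell a Finset.univ)) : ∃ f, Supports a s f := by
  have hconv := convex_cell a Finset.univ
  obtain ⟨f, hf⟩ := geometric_hahn_banach_open_point hconv.interior isOpen_interior hb
  have hle : ∀ x ∈ cell a Finset.univ, f x ≤ f (bary a l) := by
    intro x hx
    have h1 : x ∈ closure (interior (cell a Finset.univ)) := by
      rw [hconv.closure_interior_eq_closure_of_nonempty_interior hint]
      exact subset_closure hx
    exact closure_minimal (t := {x | f x ≤ f (bary a l)}) (fun x hx => (hf x hx).le)
      (isClosed_le f.continuous continuous_const) h1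
  have hvert : ∀ i ∈ s, f (a i) = f (bary a l) := by
    intro i hi
    have hsum : ∑ j, l j * (f (bary a l) - f (a j)) = 0 := by
      have : f (bary a l) = ∑ j, l j * f (a j) := by
        rw [bary_apply, map_sum]; simp
      simp only [mul_sub, Finset.sum_sub_distrib, ← Finset.sum_mul, hl.1.2, ← this]
      ring
    have hz := (Finset.sum_eq_zero_iff_of_nonneg (fun j _ => mul_nonneg (hl.1.1 j)
      (sub_nonneg.2 (hle _ (mem_cell_of_mem a (Finset.mem_univ j)))))).1 hsum i (Finset.mem_univ i)
    rcases mul_eq_zero.1 hz with h | h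
    · exact absurd h (hpos i hi).ne'
    · linarith
  have heq : ∀ y ∈ cell a s, f y = f (bary a l) := by
    have hC : Convex ℝ {y | f y = f (bary a l)} :=
      convex_hyperplane f.toLinearMap.isLinear _
    exact fun y hy => cell_subset_of_convex hC hvert hy
  exact ⟨f, fun x hx y hy => (heq y hy).symm ▸ hle x hx, fun x hx y hy => (heq y hy).symm ▸ hf x hx⟩

theorem IsFacet.cell_subset_frontier {a : ι → E} {h : ι → ℝ} {s : Finset ι} (hs : IsFacet a h s) :
    cell a s ⊆ frontier (cell a Finset.univ) := by
  obtain ⟨f, hf⟩ := hs.supp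
  intro y hy
  rw [(isCompact_cell a _).isClosed.frontier_eq]
  exact ⟨cell_mono (Finset.subset_univ _) hy, fun hy' => (hf.2 y hy' y hy).false⟩

/-- The points whose translates along `c` meet a low-dimensional cell lie in a proper affine
subspace. -/
theorem exists_affineSubspace_of_card_lt (a : ι → E) (c : E) {s : Finset ι}
    (hs : s.card < Module.finrank ℝ E) :
    ∃ A : AffineSubspace ℝ E, A ≠ ⊤ ∧ ∀ y, ∀ t : ℝ, y + t • c ∈ cell a s → y ∈ A := by
  classical
  rcases s.eq_empty_or_nonempty with rfl | ⟨i₀, hi₀⟩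
  · refine ⟨⊥, bot_ne_top, ?_⟩
    rintro y t ⟨l, ⟨hl, hl0⟩, -⟩
    have : ∑ i, l i = 0 := Finset.sum_eq_zero fun i _ => hl0 i (by simp)
    exact absurd (this.symm.trans hl.2) (by norm_num)
  -- The base vertex costs one generator and `c` adds one back, so `W` has at most `s.card`
  -- generators and is proper.
  · let W : Submodule ℝ E := Submodule.span ℝ
      (↑(insert c ((s.erase i₀).image fun i => a i - a i₀)) : Set E)
    have hW : W ≠ ⊤ := by
      intro hW
      have h1 : Module.finrank ℝ W ≤ _ := finrank_span_finset_le_card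
        (insert c ((s.erase i₀).image fun i => a i - a i₀))
      have h2 : (insert c ((s.erase i₀).image fun i => a i - a i₀)).card ≤ s.card :=
        calc _ ≤ ((s.erase i₀).image fun i => a i - a i₀).card + 1 := Finset.card_insert_le _ _
          _ ≤ (s.erase i₀).card + 1 := by gcongr; exact Finset.card_image_le
          _ = s.card := Finset.card_erase_add_one hi₀
      rw [hW, finrank_top] at h1
      omega
    refine ⟨AffineSubspace.mk' (a i₀) W, ?_, ?_⟩
    · intro h
      apply hW
      rw [← AffineSubspace.direction_mk' (a i₀) W, h, AffineSubspace.direction_top]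
    · intro y t hy
      rw [AffineSubspace.mem_mk', vsub_eq_sub]
      have hsub : cell a s ⊆ (AffineSubspace.mk' (a i₀) W : Set E) := by
        refine cell_subset_of_convex (AffineSubspace.convex _) fun i hi => ?_
        rw [SetLike.mem_coe, AffineSubspace.mem_mk', vsub_eq_sub]
        by_cases h : i = i₀
        · simp [h]
        · apply Submodule.subset_span
          simp only [Finset.coe_insert, Finset.coe_image]
          exact Set.mem_insert_of_mem _ ⟨i, by simp [h, hi], rfl⟩
      have h1 := hsub hy
      rw [SetLike.mem_coe, AffineSubspace.mem_mk', vsub_eq_sub] at h1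
      have hc : c ∈ W := Submodule.subset_span (by simp)
      have : y - a i₀ = (y + t • c - a i₀) - t • c := by abel
      rw [this]
      exact W.sub_mem h1 (W.smul_mem t hc)

/-- Differences from one point of an affinely independent family are linearly independent. -/
theorem AffIndepOn.linearIndependent {κ : Type*} {a : ι → E} {s : Finset ι} (hs : AffIndepOn a s)
    {i₀ : ι} (hi₀ : i₀ ∈ s) {w : κ → ι} (hw : Function.Injective w) (hws : ∀ k, w k ∈ s)
    (hw₀ : ∀ k, w k ≠ i₀) : LinearIndependent ℝ fun k => a (w k) - a i₀ := by
  classical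
  have : Finite κ := Finite.of_injective w hw
  have := Fintype.ofFinite κ
  rw [Fintype.linearIndependent_iff]
  intro g hg k
  have hv := hs (∑ j, g j • (Pi.single (w j) 1 - Pi.single i₀ 1)) ?_ ?_ ?_
  · have := congrFun hv (w k)
    simpa [Finset.sum_apply, Pi.single_apply, hw.eq_iff, hw₀ k] using this
  · intro i hi
    have h1 : ∀ j, i ≠ w j := fun j h => hi (h ▸ hws j)
    have h2 : i ≠ i₀ := fun h => hi (h ▸ hi₀)
    simp [Finset.sum_apply, h1, h2]
  · simp only [Finset.sum_apply, Pi.smul_apply, Pi.sub_apply, smul_eq_mul]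
    rw [Finset.sum_comm]
    simp [← Finset.mul_sum]
  · rw [map_sum, ← hg]
    simp [bary]

variable [FiniteDimensional ℝ E]

/-- An affinely independent family of points in a supporting hyperplane is small. -/
theorem AffIndepOn.card_le_of_supports {a : ι → E} {s : Finset ι} (hs : AffIndepOn a s)
    {f : E →L[ℝ] ℝ} (hf : Supports a s f) (hint : (interior (cell a Finset.univ)).Nonempty) :
    s.card ≤ Module.finrank ℝ E := by
  classical
  rcases s.eq_empty_or_nonempty with rfl | ⟨i₀, hi₀⟩
  · simp
  obtain ⟨x, hx⟩ := hint
  have hne : f ≠ 0 := by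
    rintro rfl
    exact absurd (hf.2 x hx _ (mem_cell_of_mem a hi₀)) (by simp)
  have hli := hs.linearIndependent hi₀ (w := fun i : {i // i ∈ s.erase i₀} => i.1)
    Subtype.val_injective (fun i => Finset.mem_of_mem_erase i.2) (fun i => Finset.ne_of_mem_erase i.2)
  -- All vertices of `s` maximize `f`, so the `s.card - 1` independent differences lie in the
  -- kernel, of dimension less than that of `E`.
  have hker : ∀ i : {i // i ∈ s.erase i₀}, a i.1 - a i₀ ∈ LinearMap.ker f.toLinearMap := by
    intro i
    have h1 := hf.1 (a i) (mem_cell_of_mem a (Finset.mem_univ _)) _ (mem_cell_of_mem a hi₀)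
    have h2 := hf.1 (a i₀) (mem_cell_of_mem a (Finset.mem_univ _)) _
      (mem_cell_of_mem a (Finset.mem_of_mem_erase i.2))
    rw [LinearMap.mem_ker]
    simp only [ContinuousLinearMap.coe_coe, map_sub]
    linarith
  have hli' : LinearIndependent ℝ
      (fun i : {i // i ∈ s.erase i₀} => (⟨_, hker i⟩ : LinearMap.ker f.toLinearMap)) :=
    LinearIndependent.of_comp (LinearMap.ker f.toLinearMap).subtype hli
  have h1 := hli'.fintype_card_le_finrank
  rw [Fintype.card_coe, Finset.card_erase_of_mem hi₀] at h1
  have h2 : Module.finrank ℝ (LinearMap.ker f.toLinearMap) < Module.finrank ℝ E := by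
    apply Submodule.finrank_lt
    intro h
    rw [LinearMap.ker_eq_top] at h
    exact hne (ContinuousLinearMap.coe_injective h)
  omega

omit [FiniteDimensional ℝ E] in
/-- The last point of a closed set on a segment that leaves it. -/
theorem exists_last_mem {P : Set E} (hP : IsClosed P) {y c : E} {e : ℝ} (he : 0 ≤ e) (hy : y ∈ P)
    (hyc : y + e • c ∉ P) :
    ∃ t ∈ Set.Ico 0 e, y + t • c ∈ P ∧ ∀ u, t < u → u ≤ e → y + u • c ∉ P := by
  have hcont : Continuous fun t : ℝ => y + t • c := by fun_prop
  have hcomp : IsCompact (Set.Icc 0 e ∩ {t : ℝ | y + t • c ∈ P}) :=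
    isCompact_Icc.inter_right (hP.preimage hcont)
  obtain ⟨t, ht, hmax⟩ := hcomp.exists_isGreatest ⟨0, ⟨le_rfl, he⟩, by simpa using hy⟩
  refine ⟨t, ⟨ht.1.1, lt_of_le_of_ne ht.1.2 ?_⟩, ht.2, fun u hu hue huP => ?_⟩
  · rintro rfl
    exact hyc ht.2
  · exact (hmax ⟨⟨ht.1.1.trans hu.le, hue⟩, huP⟩).not_gt hu

omit [FiniteDimensional ℝ E] in
/-- A segment that leaves a closed set meets its frontier. -/
theorem exists_mem_frontier {P : Set E} (hP : IsClosed P) {y c : E} {e : ℝ} (he : 0 ≤ e)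
    (hy : y ∈ P) (hyc : y + e • c ∉ P) : ∃ t ∈ Set.Ico 0 e, y + t • c ∈ frontier P := by
  obtain ⟨t, ht, htP, hlast⟩ := exists_last_mem hP he hy hyc
  refine ⟨t, ht, ?_⟩
  rw [hP.frontier_eq]
  refine ⟨htP, fun hint => ?_⟩
  have hcont : Continuous fun t : ℝ => y + t • c := by fun_prop
  have h1 : ∀ᶠ u in nhdsWithin t (Set.Ioi t), y + u • c ∈ P :=
    nhdsWithin_le_nhds ((hcont.continuousAt.eventually (mem_interior_iff_mem_nhds.1 hint)))
  obtain ⟨u, hu, hu2⟩ := (h1.and (Ioc_mem_nhdsGT ht.2)).exists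
  exact hlast u hu2.1 hu2.2 hu

/-- A point of the polytope from which the direction `c` leaves the polytope at once lies on a
facet that `c` crosses outwards. -/
theorem exists_isFacet_of_exit {a : ι → E} {h : ι → ℝ} (hg : GenericHeights a h)
    (hint : (interior (cell a Finset.univ)).Nonempty) {z c : E}
    (hz : z ∈ cell a Finset.univ) (hc : ∀ e : ℝ, 0 < e → z + e • c ∉ cell a Finset.univ) :
    ∃ s, IsFacet a h s ∧ z ∈ cell a s ∧ ∀ f, Supports a s f → 0 < f c := by
  classical
  set P := cell a Finset.univ with hP
  have hPc : IsClosed P := (isCompact_cell a _).isClosed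
  have hconv : Convex ℝ P := convex_cell a _
  -- a ball around `z` that meets only the cells through `z`
  obtain ⟨r, hr, hball⟩ : ∃ r > 0, ∀ s : Finset ι, z ∉ cell a s →
      ∀ x ∈ Metric.ball z r, x ∉ cell a s := by
    have : ∀ s : Finset ι, ∀ᶠ x in nhds z, z ∉ cell a s → x ∉ cell a s := by
      intro s
      by_cases hs : z ∈ cell a s
      · simp [hs]
      · filter_upwards [(isCompact_cell a s).isClosed.isOpen_compl.mem_nhds hs] with x hx _ using hx
    obtain ⟨r, hr, h'⟩ := Metric.eventually_nhds_iff_ball.1 (Filter.eventually_all.2 this)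
    exact ⟨r, hr, fun s hs x hx => h' x hx s hs⟩
  obtain ⟨e, he, hec⟩ : ∃ e : ℝ, 0 < e ∧ e * ‖c‖ < r / 2 := by
    refine ⟨r / 2 / (‖c‖ + 1), by positivity, ?_⟩
    rw [div_mul_eq_mul_div, div_lt_iff₀ (by positivity)]
    nlinarith [norm_nonneg c]
  -- a generic interior point near `z`
  let U : Set E := interior P ∩ (Metric.ball z (r / 2) ∩ {y | y + e • c ∉ P})
  have hO : IsOpen (Metric.ball z (r / 2) ∩ {y | y + e • c ∉ P}) :=
    Metric.isOpen_ball.inter (hPc.isOpen_compl.preimage (by fun_prop : Continuous fun y => y + e • c))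
  have hU : IsOpen U := isOpen_interior.inter hO
  have hUne : U.Nonempty := by
    have hzc : z ∈ closure (interior P) := by
      rw [hconv.closure_interior_eq_closure_of_nonempty_interior hint]
      exact subset_closure hz
    obtain ⟨y, hy1, hy2⟩ := mem_closure_iff.1 hzc _ hO
      ⟨Metric.mem_ball_self (by positivity), hc e he⟩
    exact ⟨y, hy2, hy1⟩
  -- Points whose line along `c` meets a cell with too few vertices lie in finitely many proper
  -- affine subspaces, a null set, whereas `U` is open and nonempty.
  obtain ⟨y, hyU, hygen⟩ : ∃ y ∈ U, ∀ s : Finset ι, s.card < Module.finrank ℝ E →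
      ∀ t : ℝ, y + t • c ∉ cell a s := by
    have hA : ∀ s : Finset ι, ∃ A : AffineSubspace ℝ E, s.card < Module.finrank ℝ E →
        A ≠ ⊤ ∧ ∀ y, ∀ t : ℝ, y + t • c ∈ cell a s → y ∈ A := by
      intro s
      by_cases hs : s.card < Module.finrank ℝ E
      · obtain ⟨A, hA⟩ := exists_affineSubspace_of_card_lt a c hs
        exact ⟨A, fun _ => hA⟩
      · exact ⟨⊤, fun h => absurd h hs⟩
    choose A hA using hA
    borelize E
    let μ : Measure E := Measure.addHaar
    by_contra hcon
    push Not at hcon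
    have hsub : U ⊆ ⋃ s : {s : Finset ι // s.card < Module.finrank ℝ E}, (A s.1 : Set E) := by
      intro y hy
      obtain ⟨s, hs, t, ht⟩ := hcon y hy
      exact Set.mem_iUnion.2 ⟨⟨s, hs⟩, (hA s hs).2 y t ht⟩
    have h0 : μ U = 0 := measure_mono_null hsub (measure_iUnion_null fun s =>
      Measure.addHaar_affineSubspace μ _ (hA s.1 s.2).1)
    exact (hU.measure_pos μ hUne).ne' h0
  -- the exit point
  obtain ⟨t, ht, hq⟩ := exists_mem_frontier hPc he.le (interior_subset hyU.1) hyU.2.2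
  rw [hPc.frontier_eq] at hq
  obtain ⟨s, hopt, hind, l, hl, hpos, hlq⟩ := exists_optFace hg hq.1
  have hqs : y + t • c ∈ cell a s := ⟨l, hl, hlq⟩
  have hsupp : ∃ f, Supports a s f := exists_supports hint hl hpos (by rw [hlq]; exact hq.2)
  -- The exit point is within `r` of `z`, where only cells through `z` occur.
  have hzs : z ∈ cell a s := by
    by_contra hzs
    refine hball s hzs _ ?_ hqs
    have h1 : dist y z < r / 2 := hyU.2.1
    rw [Metric.mem_ball, dist_eq_norm] at *
    have h2 : ‖t • c‖ ≤ e * ‖c‖ := by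
      rw [norm_smul, Real.norm_of_nonneg ht.1]
      exact mul_le_mul_of_nonneg_right ht.2.le (norm_nonneg c)
    calc ‖y + t • c - z‖ = ‖(y - z) + t • c‖ := by congr 1; abel
      _ ≤ ‖y - z‖ + ‖t • c‖ := norm_add_le _ _
      _ < r := by linarith
  refine ⟨s, ⟨hopt, hind, ?_, hsupp⟩, hzs, ?_⟩
  · obtain ⟨f, hf⟩ := hsupp
    apply le_antisymm (hind.card_le_of_supports hf hint)
    by_contra hlt
    exact hygen s (not_le.1 hlt) t hqs
  · intro f hf
    have h1 := hf.2 y hyU.1 _ hqs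
    simp only [map_add, map_smul, smul_eq_mul] at h1
    by_contra hneg
    nlinarith [ht.1, not_lt.1 hneg]

/-- A vertex that is an extreme point lies on at least `dim E` facets. -/
theorem finrank_le_card_facets {a : ι → E} {h : ι → ℝ} (hg : GenericHeights a h)
    (hint : (interior (cell a Finset.univ)).Nonempty) {z : E}
    (hz : z ∈ (cell a Finset.univ).extremePoints ℝ) (T : Finset (Finset ι))
    (hT : ∀ s, IsFacet a h s → z ∈ cell a s → s ∈ T) (hT' : ∀ s ∈ T, IsFacet a h s) :
    Module.finrank ℝ E ≤ T.card := by
  by_contra hlt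
  push Not at hlt
  have hf : ∀ s : T, ∃ f, Supports a s.1 f := fun s => (hT' s.1 s.2).supp
  choose f hf using hf
  let g : E →ₗ[ℝ] (T → ℝ) := LinearMap.pi fun s => (f s).toLinearMap
  -- With fewer functionals than dimensions some `c ≠ 0` is tangent to all facets through `z`. Then
  -- neither `c` nor `-c` leaves the polytope at once, and `z` is inside a segment.
  obtain ⟨c, hc, hc0⟩ := (LinearMap.ker g).ne_bot_iff.1
    (LinearMap.ker_ne_bot_of_finrank_lt (f := g) (by simpa using hlt))
  have hfc : ∀ s : T, f s c = 0 := fun s => congrFun (LinearMap.mem_ker.1 hc) s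
  have main : ∀ c' : E, (∀ s : T, f s c' = 0) →
      ∃ e : ℝ, 0 < e ∧ z + e • c' ∈ cell a Finset.univ := by
    intro c' hc'
    by_contra hcon
    push Not at hcon
    obtain ⟨s, hs, hzs, hpos⟩ := exists_isFacet_of_exit hg hint hz.1 hcon
    exact (hpos _ (hf ⟨s, hT s hs hzs⟩)).ne' (hc' _)
  obtain ⟨e₁, he₁, hm₁⟩ := main c hfc
  obtain ⟨e₂, he₂, hm₂⟩ := main (-c) (fun s => by simp [hfc s])
  have hseg : z ∈ openSegment ℝ (z + e₁ • c) (z + e₂ • -c) := by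
    refine ⟨e₂ / (e₁ + e₂), e₁ / (e₁ + e₂), by positivity, by positivity, by field_simp; ring, ?_⟩
    have h1 : e₂ / (e₁ + e₂) + e₁ / (e₁ + e₂) = 1 := by field_simp; ring
    calc _ = (e₂ / (e₁ + e₂) + e₁ / (e₁ + e₂)) • z +
        (e₂ / (e₁ + e₂) * e₁ - e₁ / (e₁ + e₂) * e₂) • c := by module
      _ = z := by
        rw [h1, show e₂ / (e₁ + e₂) * e₁ - e₁ / (e₁ + e₂) * e₂ = 0 by ring]; simp
  have := hz.2 hm₁ hm₂ hseg
  have h0 : e₁ • c = 0 := by simpa using this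
  rcases smul_eq_zero.1 h0 with h | h
  · exact he₁.ne' h
  · exact hc0 h

end Facets

/-! ### Counting lattice points by determinants -/

section Lattice

variable {n d : ℕ}

theorem integerLattice_add {x y : EuclideanSpace ℝ (Fin n)} (hx : x ∈ integerLattice n)
    (hy : y ∈ integerLattice n) : x + y ∈ integerLattice n := by
  intro i
  obtain ⟨k, hk⟩ := hx i
  obtain ⟨l, hl⟩ := hy i
  exact ⟨k + l, by simp [hk, hl]⟩

theorem integerLattice_zsmul {x : EuclideanSpace ℝ (Fin n)} (k : ℤ) (hx : x ∈ integerLattice n) :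
    k • x ∈ integerLattice n := by
  intro i
  obtain ⟨l, hl⟩ := hx i
  exact ⟨k * l, by simp [hl]⟩

theorem integerLattice_zero : (0 : EuclideanSpace ℝ (Fin n)) ∈ integerLattice n :=
  fun _ => ⟨0, by simp⟩

theorem integerLattice_sub {x y : EuclideanSpace ℝ (Fin n)} (hx : x ∈ integerLattice n)
    (hy : y ∈ integerLattice n) : x - y ∈ integerLattice n := by
  have := integerLattice_add hx (integerLattice_zsmul (-1) hy)
  simpa [sub_eq_add_neg] using this

theorem integerLattice_single (j : Fin n) :
    EuclideanSpace.single j (1 : ℝ) ∈ integerLattice n := by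
  intro i
  by_cases h : i = j
  · exact ⟨1, by simp [h]⟩
  · exact ⟨0, by simp [h]⟩

theorem countable_integerLattice : (integerLattice n).Countable := by
  refine (Set.countable_range
    fun k : Fin n → ℤ => WithLp.toLp 2 fun i => (k i : ℝ)).mono fun x hx => ?_
  choose k hk using hx
  exact ⟨k, by ext i; simp [hk]⟩

/-- The open unit cube centred at the origin. -/
def unitCube (n : ℕ) : Set (EuclideanSpace ℝ (Fin n)) := {x | ∀ i, x i ∈ Set.Ioo (-1 / 2 : ℝ) (1 / 2)}

theorem unitCube_eq_preimage :
    unitCube n = (WithLp.ofLp : EuclideanSpace ℝ (Fin n) → Fin n → ℝ) ⁻¹'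
      Set.univ.pi fun _ => Set.Ioo (-1 / 2 : ℝ) (1 / 2) := by
  ext x; simp [unitCube]

theorem measurableSet_unitCube : MeasurableSet (unitCube n) := by
  rw [unitCube_eq_preimage]
  exact (PiLp.volume_preserving_ofLp (Fin n)).measurable
    (MeasurableSet.univ_pi fun _ => measurableSet_Ioo)

theorem volume_unitCube : volume (unitCube n) = 1 := by
  rw [unitCube_eq_preimage, (PiLp.volume_preserving_ofLp (Fin n)).measure_preimage
    (MeasurableSet.univ_pi fun _ => measurableSet_Ioo).nullMeasurableSet, volume_pi_pi]
  norm_num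

/-- Translates of the unit cube by distinct lattice points are disjoint. -/
theorem eq_of_add_unitCube {z z' u u' : EuclideanSpace ℝ (Fin n)} (hz : z ∈ integerLattice n)
    (hz' : z' ∈ integerLattice n) (hu : u ∈ unitCube n) (hu' : u' ∈ unitCube n)
    (h : z + u = z' + u') : z = z' := by
  ext i
  obtain ⟨k, hk⟩ := hz i
  obtain ⟨k', hk'⟩ := hz' i
  have h1 := congrArg (fun v : EuclideanSpace ℝ (Fin n) => v i) h
  simp only [PiLp.add_apply, hk, hk'] at h1
  have h2 := hu i
  have h3 := hu' i
  have h4 : (k : ℝ) < k' + 1 := by linarith [h2.1, h2.2, h3.1, h3.2]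
  have h5 : (k' : ℝ) < k + 1 := by linarith [h2.1, h2.2, h3.1, h3.2]
  have h6 : k < k' + 1 := by exact_mod_cast h4
  have h7 : k' < k + 1 := by exact_mod_cast h5
  rw [hk, hk', show k = k' by omega]

/-- The determinant in coordinates, as an alternating form. -/
noncomputable def detForm (n : ℕ) :
    EuclideanSpace ℝ (Fin n) [⋀^Fin n]→ₗ[ℝ] ℝ := (EuclideanSpace.basisFun (Fin n) ℝ).toBasis.det

theorem detForm_apply (v : Fin n → EuclideanSpace ℝ (Fin n)) :
    detForm n v = (Matrix.of fun i j => v j i).det := by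
  rw [detForm, Module.Basis.det_apply]
  congr 1

theorem detForm_int {v : Fin n → EuclideanSpace ℝ (Fin n)} (hv : ∀ i, v i ∈ integerLattice n) :
    ∃ k : ℤ, detForm n v = k := by
  choose k hk using hv
  refine ⟨(Matrix.of fun i j => k j i).det, ?_⟩
  rw [detForm_apply, Int.cast_det]
  congr 1
  ext i j
  simp [hk]

theorem detForm_ne_zero {v : Fin n → EuclideanSpace ℝ (Fin n)} (hv : LinearIndependent ℝ v) :
    detForm n v ≠ 0 :=
  ((Module.Basis.is_basis_iff_det _).1 ⟨hv, hv.span_eq_top_of_card_eq_finrank' (by simp)⟩).ne_zero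

theorem volume_fundamentalDomain_euclidean
    (b : Module.Basis (Fin n) ℝ (EuclideanSpace ℝ (Fin n))) :
    volume (ZSpan.fundamentalDomain b) = ENNReal.ofReal |detForm n b| := by
  rw [ZSpan.measure_fundamentalDomain b volume (EuclideanSpace.basisFun (Fin n) ℝ).toBasis,
    measure_congr (ZSpan.fundamentalDomain_ae_parallelepiped _ volume),
    OrthonormalBasis.coe_toBasis, OrthonormalBasis.volume_parallelepiped, mul_one]
  rfl

/-- A translate of a half-open lattice parallelepiped contains at most as many lattice points as
its volume. -/
theorem card_le_abs_detForm (b : Module.Basis (Fin n) ℝ (EuclideanSpace ℝ (Fin n)))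
    (hb : ∀ i, b i ∈ integerLattice n) (S : Finset (EuclideanSpace ℝ (Fin n)))
    (hS : ∀ z ∈ S, z ∈ integerLattice n) (p : EuclideanSpace ℝ (Fin n))
    (hp : ∀ z ∈ S, z - p ∈ ZSpan.fundamentalDomain b) : (S.card : ℝ) ≤ |detForm n b| := by
  -- Blichfeldt's argument: the cubes around `S` have total volume `S.card`. If that exceeded the
  -- covolume of the lattice spanned by `b`, two translates of `U` by distinct vectors of that
  -- lattice would overlap.
  let U : Set (EuclideanSpace ℝ (Fin n)) := ⋃ z ∈ S, (fun x => z + x) '' unitCube n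
  have hmeas : ∀ z : EuclideanSpace ℝ (Fin n), MeasurableSet ((fun x => z + x) '' unitCube n) :=
    fun z => (MeasurableEquiv.addLeft z).measurableSet_image.2 measurableSet_unitCube
  have hU : volume U = S.card := by
    rw [measure_biUnion_finset _ fun z _ => hmeas z]
    · simp [volume_unitCube]
    · intro z hz z' hz' hne
      rw [Function.onFun, Set.disjoint_left]
      rintro _ ⟨u, hu, rfl⟩ ⟨u', hu', h⟩
      exact hne (eq_of_add_unitCube (hS z hz) (hS z' hz') hu hu' h.symm)
  have hspan : ∀ x ∈ Submodule.span ℤ (Set.range b), x ∈ integerLattice n := by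
    intro x hx
    induction hx using Submodule.span_induction with
    | mem x hx => obtain ⟨i, rfl⟩ := hx; exact hb i
    | zero => exact integerLattice_zero
    | add x y _ _ h1 h2 => exact integerLattice_add h1 h2
    | smul k x _ h => exact integerLattice_zsmul k h
  by_contra hlt
  push Not at hlt
  have hvol : volume (ZSpan.fundamentalDomain b) < volume U := by
    rw [volume_fundamentalDomain_euclidean, hU, ← ENNReal.ofReal_natCast]
    exact (ENNReal.ofReal_lt_ofReal_iff_of_nonneg (abs_nonneg _)).2 hlt
  have : Countable (Submodule.span ℤ (Set.range b)).toAddSubgroup :=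
    (countable_integerLattice.mono hspan).to_subtype
  obtain ⟨x, y, hxy, hdis⟩ := exists_pair_mem_lattice_not_disjoint_vadd
    (ZSpan.isAddFundamentalDomain' b volume)
    (Finset.measurableSet_biUnion S fun z _ => hmeas z).nullMeasurableSet hvol
  obtain ⟨q, hq1, hq2⟩ := Set.not_disjoint_iff.1 hdis
  obtain ⟨q1, hq1, hq'⟩ := Set.mem_vadd_set.1 hq1
  obtain ⟨q2, hq2, hq⟩ := Set.mem_vadd_set.1 hq2
  simp only [Set.mem_iUnion, exists_prop] at hq1 hq2
  obtain ⟨z, hz, u, hu, rfl⟩ := hq1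
  obtain ⟨z', hz', u', hu', rfl⟩ := hq2
  rw [← hq'] at hq
  simp only [AddSubgroup.vadd_def, vadd_eq_add, ← add_assoc] at hq
  have h1 := eq_of_add_unitCube (integerLattice_add (hspan y y.2) (hS z' hz'))
    (integerLattice_add (hspan x x.2) (hS z hz)) hu' hu hq
  have h2 : z = z' := by
    -- Both `z - p` and `z' - p` lie in the fundamental domain and are congruent modulo the span of
    -- `b`, hence equal.
    have e1 := ZSpan.fract_eq_self.2 (hp z hz)
    have e2 := ZSpan.fract_eq_self.2 (hp z' hz')
    have e3 : ZSpan.fract b (z - p) = ZSpan.fract b (z' - p) := by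
      rw [ZSpan.fract_eq_fract]
      have : -(z - p) + (z' - p) = (x - y : EuclideanSpace ℝ (Fin n)) := by
        rw [show -(z - p) + (z' - p) = (y + z') - z - y by abel, h1]
        abel
      rw [this]
      exact Submodule.sub_mem _ (show (x : EuclideanSpace ℝ (Fin n)) ∈ Submodule.span ℤ (Set.range b) from x.2) y.2
    rw [e1, e2] at e3
    exact sub_left_injective e3
  subst h2
  exact hxy (Subtype.ext (add_right_cancel h1).symm)

/-- The linear form `c ↦ det (c, m₁, …, m_d)`. -/
noncomputable def edgeForm (m : Fin d → EuclideanSpace ℝ (Fin (d + 1))) :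
    EuclideanSpace ℝ (Fin (d + 1)) →ₗ[ℝ] ℝ where
  toFun c := detForm (d + 1) (Fin.cons c m)
  map_add' x y := (detForm (d + 1)).toMultilinearMap.cons_add m x y
  map_smul' t x := (detForm (d + 1)).toMultilinearMap.cons_smul m t x

theorem edgeForm_apply (m : Fin d → EuclideanSpace ℝ (Fin (d + 1)))
    (c : EuclideanSpace ℝ (Fin (d + 1))) : edgeForm m c = detForm (d + 1) (Fin.cons c m) := rfl

theorem edgeForm_edge (m : Fin d → EuclideanSpace ℝ (Fin (d + 1))) (i : Fin d) :
    edgeForm m (m i) = 0 :=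
  (detForm (d + 1)).map_eq_zero_of_eq _ (i := 0) (j := i.succ) (by simp)
    (Fin.succ_ne_zero i).symm

theorem edgeForm_ne_zero {m : Fin d → EuclideanSpace ℝ (Fin (d + 1))}
    (hm : LinearIndependent ℝ m) : edgeForm m ≠ 0 := by
  have hspan : Submodule.span ℝ (Set.range m) ≠ ⊤ := by
    intro h
    have h1 := finrank_span_eq_card hm
    rw [h, finrank_top] at h1
    simp at h1
  obtain ⟨c, -, hc⟩ := SetLike.exists_of_lt hspan.lt_top
  intro h
  have := detForm_ne_zero (linearIndependent_finCons.2 ⟨hm, hc⟩)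
  exact this (congrArg (fun f => f c) h)

/-- The vector representing `edgeForm m`. -/
noncomputable def edgeNormal (m : Fin d → EuclideanSpace ℝ (Fin (d + 1))) :
    EuclideanSpace ℝ (Fin (d + 1)) :=
  WithLp.toLp 2 fun j => edgeForm m (EuclideanSpace.single j 1)

theorem edgeForm_eq_sum (m : Fin d → EuclideanSpace ℝ (Fin (d + 1)))
    (c : EuclideanSpace ℝ (Fin (d + 1))) : edgeForm m c = ∑ j, c j * edgeNormal m j := by
  conv_lhs => rw [← (EuclideanSpace.basisFun (Fin (d + 1)) ℝ).sum_repr c]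
  simp [edgeNormal]

theorem edgeForm_eq_inner (m : Fin d → EuclideanSpace ℝ (Fin (d + 1)))
    (c : EuclideanSpace ℝ (Fin (d + 1))) : edgeForm m c = inner ℝ (edgeNormal m) c := by
  rw [edgeForm_eq_sum, PiLp.inner_apply]
  simp

/-- A lattice vector on which the form of an integral family of edges takes a generating value. -/
theorem exists_generator {m : Fin d → EuclideanSpace ℝ (Fin (d + 1))}
    (hm : LinearIndependent ℝ m) (hmZ : ∀ i, m i ∈ integerLattice (d + 1)) :
    ∃ b ∈ integerLattice (d + 1), edgeForm m b ≠ 0 ∧ |edgeForm m b| ≤ ‖edgeNormal m‖ ∧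
      1 ≤ |edgeForm m b| ∧ ∀ z ∈ integerLattice (d + 1), ∃ k : ℤ, edgeForm m z = k * edgeForm m b := by
  have hint : ∀ z ∈ integerLattice (d + 1), ∃ k : ℤ, edgeForm m z = k := fun z hz =>
    detForm_int (v := Fin.cons z m) (fun i => by
      refine Fin.cases ?_ (fun i => ?_) i
      · simpa using hz
      · simpa using hmZ i)
  -- The values of the form on the lattice are an ideal of `ℤ`; `b` realizes its generator.
  let I : Ideal ℤ :=
    { carrier := {k | ∃ z ∈ integerLattice (d + 1), edgeForm m z = k}
      add_mem' := by
        rintro k l ⟨z, hz, h1⟩ ⟨y, hy, h2⟩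
        exact ⟨z + y, integerLattice_add hz hy, by simp [h1, h2]⟩
      zero_mem' := ⟨0, integerLattice_zero, by simp⟩
      smul_mem' := by
        rintro k l ⟨z, hz, h1⟩
        exact ⟨k • z, integerLattice_zsmul k hz, by simp [h1]⟩ }
  obtain ⟨b, hb, hbg⟩ := Submodule.IsPrincipal.generator_mem I
  have hgen : ∀ z ∈ integerLattice (d + 1), ∃ k : ℤ, edgeForm m z = k * edgeForm m b := by
    intro z hz
    obtain ⟨k, hk⟩ := hint z hz
    obtain ⟨l, hl⟩ := (Submodule.IsPrincipal.mem_iff_eq_smul_generator I).1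
      (show k ∈ I from ⟨z, hz, hk⟩)
    refine ⟨l, ?_⟩
    rw [hk, hbg, hl]
    simp
  obtain ⟨j, hj⟩ : ∃ j, edgeForm m (EuclideanSpace.single j 1) ≠ 0 := by
    by_contra hcon
    push Not at hcon
    apply edgeForm_ne_zero hm
    ext c
    rw [edgeForm_eq_sum]
    simp [edgeNormal, hcon]
  obtain ⟨k, hk⟩ := hgen _ (integerLattice_single j)
  have hb0 : edgeForm m b ≠ 0 := fun h => hj (by rw [hk, h, mul_zero])
  have hk0 : k ≠ 0 := fun h => hj (by rw [hk, h]; simp)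
  refine ⟨b, hb, hb0, ?_, ?_, hgen⟩
  -- The `j`-th coordinate of the normal is a nonzero integer multiple of the generating value.
  · have h1 : (1 : ℝ) ≤ |(k : ℝ)| := by exact_mod_cast Int.one_le_abs hk0
    calc |edgeForm m b| ≤ |(k : ℝ)| * |edgeForm m b| := le_mul_of_one_le_left (abs_nonneg _) h1
      _ = ‖edgeNormal m j‖ := by rw [← abs_mul, ← hk]; rfl
      _ ≤ ‖edgeNormal m‖ := PiLp.norm_apply_le _ _
  · rw [hbg] at hb0 ⊢
    have : Submodule.IsPrincipal.generator I ≠ 0 := by exact_mod_cast hb0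
    exact_mod_cast Int.one_le_abs this

/-- At most `|edgeForm m b|` lattice points lie in a translate of the half-open parallelotope
spanned by `m`. -/
theorem card_le_abs_edgeForm {m : Fin d → EuclideanSpace ℝ (Fin (d + 1))}
    (hm : LinearIndependent ℝ m) (hmZ : ∀ i, m i ∈ integerLattice (d + 1))
    {b : EuclideanSpace ℝ (Fin (d + 1))} (hb : b ∈ integerLattice (d + 1)) (hb0 : edgeForm m b ≠ 0)
    (S : Finset (EuclideanSpace ℝ (Fin (d + 1)))) (hS : ∀ z ∈ S, z ∈ integerLattice (d + 1))
    (p : EuclideanSpace ℝ (Fin (d + 1)))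
    (hp : ∀ z ∈ S, ∃ l : Fin d → ℝ, (∀ i, l i ∈ Set.Ico (0 : ℝ) 1) ∧ z - p = ∑ i, l i • m i) :
    (S.card : ℝ) ≤ |edgeForm m b| := by
  have hli : LinearIndependent ℝ (Fin.cons b m : Fin (d + 1) → EuclideanSpace ℝ (Fin (d + 1))) := by
    refine linearIndependent_finCons.2 ⟨hm, fun hbs => hb0 ?_⟩
    have : Submodule.span ℝ (Set.range m) ≤ LinearMap.ker (edgeForm m) := by
      rw [Submodule.span_le]
      rintro _ ⟨i, rfl⟩
      exact edgeForm_edge m i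
    exact this hbs
  let B := basisOfLinearIndependentOfCardEqFinrank hli (by simp)
  have hB : (B : Fin (d + 1) → EuclideanSpace ℝ (Fin (d + 1))) = Fin.cons b m :=
    coe_basisOfLinearIndependentOfCardEqFinrank hli (by simp)
  have := card_le_abs_detForm B ?_ S hS p ?_
  · rwa [hB] at this
  · intro i
    rw [hB]
    refine Fin.cases ?_ (fun i => ?_) i
    · simpa using hb
    · simpa using hmZ i
  · intro z hz
    obtain ⟨l, hl, hzl⟩ := hp z hz
    rw [ZSpan.mem_fundamentalDomain]
    -- The added basis vector `b` gets coordinate 0, which is allowed in the half-open fundamental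
    -- domain.
    have hrep : z - p = ∑ i, (Fin.cons 0 l : Fin (d + 1) → ℝ) i • B i := by
      rw [hB, Fin.sum_univ_succ, hzl]
      simp
    intro i
    rw [hrep, Module.Basis.repr_sum_self]
    refine Fin.cases ?_ (fun i => ?_) i
    · simp
    · simpa using hl i

/-- The edges at the vertex `w 0`. -/
def edges (w : Fin (d + 1) → EuclideanSpace ℝ (Fin (d + 1))) (i : Fin d) :
    EuclideanSpace ℝ (Fin (d + 1)) := w i.succ - w 0

/-- The simplex with the vertices `w`. -/
def simplexOf (w : Fin (d + 1) → EuclideanSpace ℝ (Fin (d + 1))) :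
    Set (EuclideanSpace ℝ (Fin (d + 1))) :=
  {x | ∃ l : Fin d → ℝ, (∀ i, 0 ≤ l i) ∧ ∑ i, l i ≤ 1 ∧ x = w 0 + ∑ i, l i • edges w i}

/-- Barycentric coordinates are less than one except at a vertex. -/
theorem exists_coord_of_mem_simplexOf {w : Fin (d + 1) → EuclideanSpace ℝ (Fin (d + 1))}
    {x : EuclideanSpace ℝ (Fin (d + 1))} (hx : x ∈ simplexOf w) (hne : ∀ i : Fin d, x ≠ w i.succ) :
    ∃ l : Fin d → ℝ, (∀ i, l i ∈ Set.Ico (0 : ℝ) 1) ∧ x - w 0 = ∑ i, l i • edges w i := by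
  classical
  obtain ⟨l, hl0, hl1, rfl⟩ := hx
  refine ⟨l, fun i => ⟨hl0 i, ?_⟩, by simp⟩
  by_contra hi
  push Not at hi
  have hsum := Finset.add_sum_erase Finset.univ l (Finset.mem_univ i)
  have hrest : ∑ j ∈ Finset.univ.erase i, l j = 0 :=
    le_antisymm (by linarith) (Finset.sum_nonneg fun j _ => hl0 j)
  have hli : l i = 1 := by linarith
  have hz := (Finset.sum_eq_zero_iff_of_nonneg fun j _ => hl0 j).1 hrest
  apply hne i
  rw [Finset.sum_eq_single i]
  · simp [hli, edges]
  · intro j _ hj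
    rw [hz j (Finset.mem_erase.2 ⟨hj, Finset.mem_univ j⟩), zero_smul]
  · simp

theorem edgeForm_of_mem_simplexOf {w : Fin (d + 1) → EuclideanSpace ℝ (Fin (d + 1))}
    {x : EuclideanSpace ℝ (Fin (d + 1))} (hx : x ∈ simplexOf w) :
    edgeForm (edges w) x = edgeForm (edges w) (w 0) := by
  obtain ⟨l, -, -, rfl⟩ := hx
  simp [edgeForm_edge]

/-- The lattice points that reach a lattice simplex when moved along a proper part of `c`. -/
theorem card_sweep_le {w : Fin (d + 1) → EuclideanSpace ℝ (Fin (d + 1))}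
    (hw : ∀ i, w i ∈ integerLattice (d + 1)) (hli : LinearIndependent ℝ (edges w))
    {c : EuclideanSpace ℝ (Fin (d + 1))} (hc : edgeForm (edges w) c ≠ 0)
    (S : Finset (EuclideanSpace ℝ (Fin (d + 1)))) (hS : ∀ z ∈ S, z ∈ integerLattice (d + 1))
    (hsweep : ∀ z ∈ S, ∃ t ∈ Set.Ioo (0 : ℝ) 1, z + t • c ∈ simplexOf w ∧
      ∀ i : Fin d, z + t • c ≠ w i.succ) : (S.card : ℝ) ≤ |edgeForm (edges w) c| := by
  classical
  set φ := edgeForm (edges w) with hφ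
  have hmZ : ∀ i, edges w i ∈ integerLattice (d + 1) := fun i => integerLattice_sub (hw _) (hw _)
  obtain ⟨b, hb, hb0, -, -, hgen⟩ := exists_generator hli hmZ
  have hbpos : 0 < |φ b| := abs_pos.2 hb0
  have hcpos : 0 < |φ c| := abs_pos.2 hc
  -- `k` is the number of lattice layers, level sets of `φ` spaced by `|φ b|`, between `z` and the
  -- hyperplane of the simplex; off `S` it is a dummy 0.
  have hk : ∀ z : EuclideanSpace ℝ (Fin (d + 1)), ∃ k : ℕ, z ∈ S → ∃ t ∈ Set.Ioo (0 : ℝ) 1,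
      z + t • c ∈ simplexOf w ∧ (∀ i : Fin d, z + t • c ≠ w i.succ) ∧
        (k : ℝ) * |φ b| = t * |φ c| := by
    intro z
    by_cases hz : z ∈ S
    · obtain ⟨t, ht, h1, h2⟩ := hsweep z hz
      obtain ⟨k, hk⟩ := hgen _ (integerLattice_sub (hw 0) (hS z hz))
      refine ⟨k.natAbs, fun _ => ⟨t, ht, h1, h2, ?_⟩⟩
      have h3 := edgeForm_of_mem_simplexOf h1
      rw [map_add, map_smul, smul_eq_mul] at h3
      rw [map_sub, ← h3] at hk
      rw [Nat.cast_natAbs, Int.cast_abs, ← abs_mul, ← hk, add_sub_cancel_left, abs_mul,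
        abs_of_pos ht.1]
    · exact ⟨0, fun h => absurd h hz⟩
  choose k hk using hk
  let N := ⌈|φ c| / |φ b|⌉₊
  have himg : ∀ z ∈ S, k z ∈ Finset.Ioo 0 N := by
    intro z hz
    obtain ⟨t, ht, -, -, h⟩ := hk z hz
    rw [Finset.mem_Ioo]
    constructor
    · have : 0 < (k z : ℝ) * |φ b| := by rw [h]; exact mul_pos ht.1 hcpos
      exact_mod_cast pos_of_mul_pos_left this hbpos.le
    · rw [Nat.lt_ceil, lt_div_iff₀ hbpos, h]
      exact mul_lt_of_lt_one_left hcpos ht.2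
  -- The points of one layer reach the simplex at the same time `j * |φ b| / |φ c|`, so a single
  -- translation puts them all into the half-open parallelotope.
  have hfib : ∀ j ∈ Finset.Ioo 0 N, ((S.filter fun z => k z = j).card : ℝ) ≤ |φ b| := by
    intro j _
    refine card_le_abs_edgeForm hli hmZ hb hb0 _ (fun z hz => hS z (Finset.mem_filter.1 hz).1)
      (w 0 - ((j : ℝ) * |φ b| / |φ c|) • c) ?_
    intro z hz
    obtain ⟨hzS, hzj⟩ := Finset.mem_filter.1 hz
    obtain ⟨t, ht, h1, h2, h3⟩ := hk z hzS
    obtain ⟨l, hl, hzl⟩ := exists_coord_of_mem_simplexOf h1 h2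
    refine ⟨l, hl, ?_⟩
    rw [← hzl, ← hzj, h3, mul_div_cancel_right₀ _ hcpos.ne']
    abel
  have hcard : (S.card : ℝ) ≤ (Finset.Ioo 0 N).card * |φ b| := by
    rw [Finset.card_eq_sum_card_fiberwise (f := k) (t := Finset.Ioo 0 N) himg, Nat.cast_sum,
      ← nsmul_eq_mul]
    exact Finset.sum_le_card_nsmul _ _ _ hfib
  refine hcard.trans ?_
  rw [Nat.card_Ioo]
  -- Both end layers are excluded, which absorbs the rounding up in `N`.
  have hN : ((N - 0 - 1 : ℕ) : ℝ) ≤ |φ c| / |φ b| := by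
    have h1 := Nat.ceil_lt_add_one (div_nonneg hcpos.le hbpos.le)
    rcases Nat.eq_zero_or_pos N with h | h
    · rw [h]; simpa using div_nonneg hcpos.le hbpos.le
    · rw [Nat.sub_zero, Nat.cast_sub h, Nat.cast_one]
      linarith
  calc _ ≤ |φ c| / |φ b| * |φ b| := mul_le_mul_of_nonneg_right hN hbpos.le
    _ = |φ c| := div_mul_cancel₀ _ hbpos.ne'

end Lattice

/-! ### Areas of simplices and of convex boundaries -/

section HausdorffMeasure

open scoped ENNReal NNReal

theorem LipschitzOnWith.euclideanHausdorffMeasure_image_le {X Y : Type*} [EMetricSpace X]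
    [EMetricSpace Y] [MeasurableSpace X] [BorelSpace X] [MeasurableSpace Y] [BorelSpace Y]
    {f : X → Y} {s : Set X} (hf : LipschitzOnWith 1 f s) (d : ℕ) :
    (Measure.euclideanHausdorffMeasure d : Measure Y) (f '' s) ≤
      (Measure.euclideanHausdorffMeasure d : Measure X) s := by
  simp_rw [Measure.euclideanHausdorffMeasure_def, Measure.smul_apply]
  have := hf.hausdorffMeasure_image_le (d := d) (by positivity)
  simp only [ENNReal.coe_one, ENNReal.one_rpow, one_mul] at this
  exact smul_le_smul_of_nonneg_left this zero_le

/-- The simplex spanned by the origin and the standard basis. -/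
def cornerSimplex (d : ℕ) : Set (EuclideanSpace ℝ (Fin d)) := {x | (∀ i, 0 ≤ x i) ∧ ∑ i, x i ≤ 1}

/-- The `2 ^ d` sign changes of the simplex cover the open unit ball of the ℓ¹ norm, whose volume is
`2 ^ d / d!`. -/
theorem volume_cornerSimplex_ge (d : ℕ) :
    ENNReal.ofReal (1 / d.factorial) ≤ volume (cornerSimplex d) := by
  let D : Set (Fin d → ℝ) := {x | (∀ i, 0 ≤ x i) ∧ ∑ i, x i ≤ 1}
  have hDc : IsClosed D := by
    have : D = (⋂ i, {x : Fin d → ℝ | 0 ≤ x i}) ∩ {x | ∑ i, x i ≤ 1} := by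
      ext x; simp [D]
    rw [this]
    exact (isClosed_iInter fun i => isClosed_le continuous_const (continuous_apply i)).inter
      (isClosed_le (by fun_prop) continuous_const)
  have hD : volume (cornerSimplex d) = volume D :=
    (PiLp.volume_preserving_ofLp (Fin d)).measure_preimage hDc.measurableSet.nullMeasurableSet
  rw [hD]
  let sgn : (Fin d → Bool) → (Fin d → ℝ) → Fin d → ℝ := fun e x i => if e i then x i else - x i
  have hmp : ∀ e, MeasurePreserving (sgn e) := fun e => by
    refine volume_preserving_pi (f := fun i t => if e i then t else -t) fun i => ?_
    cases e i
    · simpa using Measure.measurePreserving_neg (volume : Measure ℝ)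
    · exact MeasurePreserving.id (volume : Measure ℝ)
  have hcover : {x : Fin d → ℝ | ∑ i, |x i| ^ (1 : ℝ) < 1} ⊆ ⋃ e, sgn e ⁻¹' D := by
    intro x hx
    refine Set.mem_iUnion.2 ⟨fun i => decide (0 ≤ x i), ?_⟩
    have habs : ∀ i, sgn (fun i => decide (0 ≤ x i)) x i = |x i| := by
      intro i
      by_cases h : 0 ≤ x i
      · simp [sgn, h, abs_of_nonneg h]
      · simp [sgn, h, abs_of_neg (not_le.1 h)]
    refine ⟨fun i => by rw [habs]; exact abs_nonneg _, ?_⟩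
    simp only [habs]
    simpa using (show ∑ i, |x i| ^ (1 : ℝ) < 1 from hx).le
  have h1 := measure_mono (μ := volume) hcover
  rw [volume_sum_rpow_lt_one (Fin d) le_rfl] at h1
  have h2 : volume (⋃ e, sgn e ⁻¹' D) ≤ (2 : ℝ≥0∞) ^ d * volume D := by
    refine (measure_iUnion_fintype_le _ _).trans ?_
    simp only [fun e => (hmp e).measure_preimage hDc.measurableSet.nullMeasurableSet]
    simp
  have h3 : (2 * Real.Gamma (1 / 1 + 1)) ^ Fintype.card (Fin d) /
      Real.Gamma (Fintype.card (Fin d) / 1 + 1) = 2 ^ d * (1 / d.factorial) := by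
    rw [Fintype.card_fin, div_one, div_one, Real.Gamma_nat_eq_factorial,
      show (1 : ℝ) + 1 = ((1 : ℕ) : ℝ) + 1 by norm_num, Real.Gamma_nat_eq_factorial]
    simp [div_eq_mul_inv]
  rw [h3, ENNReal.ofReal_mul (by positivity), ENNReal.ofReal_pow (by norm_num),
    ENNReal.ofReal_ofNat] at h1
  exact (ENNReal.mul_le_mul_iff_right (by positivity) (by simp)).1 (h1.trans h2)

variable {d : ℕ}

/-- Prepend the normal `g` to `m`. By orthogonality the Gram determinant gains the factor `‖g‖ ^ 2`;
it is also the square of `det (g, m) = ‖g‖ ^ 2`. Cancel. -/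
theorem det_gram_edges {m : Fin d → EuclideanSpace ℝ (Fin (d + 1))} (hm : LinearIndependent ℝ m) :
    (Matrix.gram ℝ m).det = ‖edgeNormal m‖ ^ 2 := by
  set g := edgeNormal m with hg
  have hg0 : g ≠ 0 := by
    intro h
    apply edgeForm_ne_zero hm
    ext c
    simp [edgeForm_eq_inner, ← hg, h]
  have h1 : (Matrix.gram ℝ (Fin.cons g m : Fin (d + 1) → EuclideanSpace ℝ (Fin (d + 1)))).det =
      edgeForm m g ^ 2 := by
    rw [edgeForm_apply, detForm_apply, sq]
    conv_rhs => enter [1]; rw [← Matrix.det_transpose]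
    rw [← Matrix.det_mul]
    congr 1
    ext i j
    simp [Matrix.mul_apply, PiLp.inner_apply, mul_comm]
  have horth : ∀ i, inner ℝ g (m i) = (0 : ℝ) := fun i => by
    rw [hg, ← edgeForm_eq_inner, edgeForm_edge]
  have h2 : (Matrix.gram ℝ (Fin.cons g m : Fin (d + 1) → EuclideanSpace ℝ (Fin (d + 1)))).det =
      ‖g‖ ^ 2 * (Matrix.gram ℝ m).det := by
    rw [Matrix.det_succ_row_zero, Fin.sum_univ_succ]
    simp only [Matrix.gram_apply, Fin.cons_zero, Fin.cons_succ, horth, real_inner_self_eq_norm_sq]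
    simp only [Fin.val_zero, pow_zero, one_mul, Fin.succAbove_zero, mul_zero, zero_mul,
      Finset.sum_const_zero, add_zero]
    congr 2
  have h3 : edgeForm m g = ‖g‖ ^ 2 := by
    rw [edgeForm_eq_inner, real_inner_self_eq_norm_sq]
  rw [h1, h3] at h2
  have h4 : ‖g‖ ^ 2 ≠ 0 := by positivity
  have h5 : ‖g‖ ^ 2 * ‖g‖ ^ 2 = ‖g‖ ^ 2 * (Matrix.gram ℝ m).det := by rw [← h2]; ring
  exact (mul_left_cancel₀ h4 h5).symm

/-- The area of a simplex in terms of the normal vector of its edges. -/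
theorem edgeNormal_le_area {w : Fin (d + 1) → EuclideanSpace ℝ (Fin (d + 1))}
    (hw : LinearIndependent ℝ (edges w)) :
    ENNReal.ofReal (‖edgeNormal (edges w)‖ * (1 / d.factorial)) ≤
      (Measure.euclideanHausdorffMeasure d : Measure (EuclideanSpace ℝ (Fin (d + 1))))
        (simplexOf w) := by
  let f : EuclideanSpace ℝ (Fin d) →ₗ[ℝ] EuclideanSpace ℝ (Fin (d + 1)) :=
    (Fintype.linearCombination ℝ (edges w)).comp
      (WithLp.linearEquiv 2 ℝ (Fin d → ℝ)).toLinearMap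
  have hf : ∀ x, f x = ∑ i, x i • edges w i := fun x => rfl
  have himg : simplexOf w = (fun x => w 0 + x) '' (f '' cornerSimplex d) := by
    ext x
    constructor
    · rintro ⟨l, h0, h1, rfl⟩
      exact ⟨_, ⟨WithLp.toLp 2 l, ⟨h0, h1⟩, rfl⟩, by simp [hf]⟩
    · rintro ⟨_, ⟨l, ⟨h0, h1⟩, rfl⟩, rfl⟩
      exact ⟨l, h0, h1, rfl⟩
  have hnd : f.normDet = ‖edgeNormal (edges w)‖ := by
    have h1 := f.normDet_sq_eq_det_gram (EuclideanSpace.basisFun (Fin d) ℝ)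
    have h2 : (fun i => f (EuclideanSpace.basisFun (Fin d) ℝ i)) = edges w := by
      funext i
      rw [hf, Finset.sum_eq_single i]
      · simp
      · intro j _ hj
        simp [hj]
      · simp
    rw [h2, det_gram_edges hw] at h1
    exact (pow_left_inj₀ f.normDet_nonneg (norm_nonneg _) two_ne_zero).1 h1
  have h3 := f.euclideanHausdorffMeasure_image_eq_normDet_mul_volume (cornerSimplex d)
  rw [finrank_euclideanSpace_fin] at h3
  rw [himg, (isometry_add_left (w 0)).euclideanHausdorffMeasure_image, h3, hnd,
    ENNReal.ofReal_mul (norm_nonneg _)]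
  gcongr
  exact volume_cornerSimplex_ge d

theorem euclideanHausdorffMeasure_cell_eq_zero {ι E : Type*} [Fintype ι] [NormedAddCommGroup E]
    [NormedSpace ℝ E] [FiniteDimensional ℝ E] [MeasurableSpace E] [BorelSpace E] (a : ι → E)
    {s : Finset ι} {d : ℕ} (hs : s.card ≤ d) :
    (Measure.euclideanHausdorffMeasure d : Measure E) (cell a s) = 0 := by
  classical
  rcases s.eq_empty_or_nonempty with rfl | hne
  · have : cell a (∅ : Finset ι) = ∅ := by
      refine Set.eq_empty_of_forall_notMem ?_
      rintro _ ⟨l, ⟨hl, hl0⟩, -⟩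
      have : ∑ i, l i = 0 := Finset.sum_eq_zero fun i _ => hl0 i (by simp)
      exact absurd (this.symm.trans hl.2) (by norm_num)
    rw [this, measure_empty]
  have hdim : dimH (convexHull ℝ (a '' s)) < ((d : ℝ≥0) : ℝ≥0∞) := by
    rw [Real.Convex.dimH_eq_finrank_vectorSpan (convex_convexHull ℝ _)
      ((hne.to_set.image a).convexHull), ← direction_affineSpan, affineSpan_convexHull,
      direction_affineSpan]
    have hc : 0 < s.card := hne.card_pos
    have h1 := finrank_vectorSpan_image_finset_le ℝ a s (n := s.card - 1) (by omega)
    rw [Finset.coe_image] at h1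
    have h2 : Module.finrank ℝ (vectorSpan ℝ (a '' (s : Set ι))) < d := by omega
    simpa using h2
  have h0 := hausdorffMeasure_of_dimH_lt hdim
  rw [Measure.euclideanHausdorffMeasure_def, Measure.smul_apply]
  have h1 : (Measure.hausdorffMeasure (d : ℝ) : Measure E) (cell a s) = 0 :=
    by rw [cell_eq_convexHull]; simpa using h0
  rw [h1, smul_zero]

/-- Surface area is monotone: the frontier of a convex body is no larger than that of a compact set
that contains it. -/
theorem euclideanHausdorffMeasure_frontier_mono {E : Type*} [NormedAddCommGroup E]
    [InnerProductSpace ℝ E] [FiniteDimensional ℝ E] [MeasurableSpace E] [BorelSpace E] {P K : Set E}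
    (hP : IsClosed P) (hconv : Convex ℝ P) (hint : (interior P).Nonempty) (hK : IsCompact K)
    (hPK : P ⊆ K) (d : ℕ) :
    (Measure.euclideanHausdorffMeasure d : Measure E) (frontier P) ≤
      (Measure.euclideanHausdorffMeasure d : Measure E) (frontier K) := by
  have hne : P.Nonempty := hint.mono interior_subset
  -- Nearest-point projection onto `P`, characterized by its variational inequality, which also
  -- makes it 1-Lipschitz.
  have hproj : ∀ u : E, ∃ v ∈ P, ∀ x ∈ P, inner ℝ (u - v) (x - v) ≤ (0 : ℝ) := by
    intro u
    obtain ⟨v, hv, h⟩ := exists_norm_eq_iInf_of_complete_convex hne hP.isComplete hconv u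
    exact ⟨v, hv, (norm_eq_iInf_iff_real_inner_le_zero hconv hv).1 h⟩
  choose π hπP hπ using hproj
  have hlip : LipschitzWith 1 π := by
    refine LipschitzWith.of_dist_le_mul fun u v => ?_
    rw [NNReal.coe_one, one_mul, dist_eq_norm, dist_eq_norm]
    have h1 := hπ u _ (hπP v)
    have h2 := hπ v _ (hπP u)
    have h3 : inner ℝ (π u - π v) (π u - π v) ≤ inner ℝ (u - v) (π u - π v) := by
      have e : inner ℝ (u - v) (π u - π v) - inner ℝ (π u - π v) (π u - π v) =
          - inner ℝ (u - π u) (π v - π u) - inner ℝ (v - π v) (π u - π v) := by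
        rw [← neg_sub (π u) (π v), inner_neg_right, neg_neg, ← inner_sub_left, ← inner_sub_left]
        congr 1
        abel
      linarith
    rw [real_inner_self_eq_norm_sq] at h3
    have h4 := real_inner_le_norm (u - v) (π u - π v)
    by_contra hlt
    push Not at hlt
    nlinarith [norm_nonneg (u - v), norm_nonneg (π u - π v)]
  have huniq : ∀ u v, v ∈ P → (∀ x ∈ P, inner ℝ (u - v) (x - v) ≤ (0 : ℝ)) → π u = v := by
    intro u v hv h
    have h1 := hπ u _ hv
    have h2 := h _ (hπP u)
    have h3 : inner ℝ (π u - v) (π u - v) ≤ (0 : ℝ) := by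
      have e : inner ℝ (π u - v) (π u - v) =
          inner ℝ (u - π u) (v - π u) + inner ℝ (u - v) (π u - v) := by
        rw [← neg_sub (π u) v, inner_neg_right, neg_add_eq_sub, ← inner_sub_left]
        congr 1
        abel
      linarith
    rw [real_inner_self_eq_norm_sq] at h3
    have : ‖π u - v‖ = 0 := by nlinarith [norm_nonneg (π u - v)]
    exact sub_eq_zero.1 (norm_eq_zero.1 this)
  -- From `q` follow an outer normal `c` of `P` until it meets the frontier of `K`; the point met
  -- projects back to `q`.
  have hsub : frontier P ⊆ π '' frontier K := by
    intro q hq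
    rw [hP.frontier_eq] at hq
    obtain ⟨f, hf⟩ := geometric_hahn_banach_open_point hconv.interior isOpen_interior hq.2
    obtain ⟨x₀, hx₀⟩ := hint
    let c := (InnerProductSpace.toDual ℝ E).symm f
    have hfc : ∀ x, f x = inner ℝ c x := fun x => by simp [c]
    have hle : ∀ x ∈ P, f x ≤ f q := by
      intro x hx
      have h1 : x ∈ closure (interior P) := by
        rw [hconv.closure_interior_eq_closure_of_nonempty_interior ⟨x₀, hx₀⟩]
        exact subset_closure hx
      exact closure_minimal (t := {x | f x ≤ f q}) (fun x hx => (hf x hx).le)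
        (isClosed_le f.continuous continuous_const) h1
    have hc0 : c ≠ 0 := by
      intro h
      have := hf x₀ hx₀
      simp [hfc, h] at this
    obtain ⟨R, hR⟩ := hK.isBounded.subset_closedBall q
    obtain ⟨e, he, hec⟩ : ∃ e : ℝ, 0 ≤ e ∧ q + e • c ∉ K := by
      refine ⟨(|R| + 1) / ‖c‖, by positivity, fun h => ?_⟩
      have h1 := hR h
      rw [Metric.mem_closedBall, dist_eq_norm, add_sub_cancel_left, norm_smul, Real.norm_eq_abs,
        abs_of_nonneg (by positivity), div_mul_cancel₀ _ (norm_ne_zero_iff.2 hc0)] at h1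
      linarith [le_abs_self R]
    obtain ⟨t, ht, htK⟩ := exists_mem_frontier hK.isClosed he (hPK hq.1) hec
    refine ⟨_, htK, huniq _ _ hq.1 fun x hx => ?_⟩
    rw [add_sub_cancel_left, inner_smul_left, inner_sub_right, ← hfc, ← hfc]
    have := hle x hx
    simp only [conj_trivial]
    nlinarith [ht.1]
  calc _ ≤ _ := measure_mono hsub
    _ ≤ _ := hlip.lipschitzOnWith.euclideanHausdorffMeasure_image_le d

/-- By monotonicity a cube around `K` suffices. Finiteness matters because `surfaceArea` is a real
number that would be 0 if the measure were infinite. -/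
theorem euclideanHausdorffMeasure_frontier_lt_top {K : Set (EuclideanSpace ℝ (Fin (d + 1)))}
    (hK : IsCompact K) (hconv : Convex ℝ K) (hint : (interior K).Nonempty) :
    (Measure.euclideanHausdorffMeasure d : Measure (EuclideanSpace ℝ (Fin (d + 1)))) (frontier K)
      < ⊤ := by
  obtain ⟨R, hR⟩ := hK.isBounded.subset_closedBall 0
  let Q : Set (EuclideanSpace ℝ (Fin (d + 1))) := {x | ∀ i, |x i| ≤ R}
  have hQc : IsClosed Q := by
    have : Q = ⋂ i, {x : EuclideanSpace ℝ (Fin (d + 1)) | |x i| ≤ R} := by ext x; simp [Q]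
    rw [this]
    exact isClosed_iInter fun i => isClosed_le (by fun_prop) continuous_const
  have hQb : Q ⊆ Metric.closedBall 0 (Real.sqrt (∑ _i : Fin (d + 1), R ^ 2)) := by
    intro x hx
    rw [mem_closedBall_zero_iff, EuclideanSpace.norm_eq]
    refine Real.sqrt_le_sqrt (Finset.sum_le_sum fun i _ => ?_)
    rw [Real.norm_eq_abs]
    exact pow_le_pow_left₀ (abs_nonneg _) (hx i) 2
  have hQ : IsCompact Q := Metric.isCompact_of_isClosed_isBounded hQc
    (Metric.isBounded_closedBall.subset hQb)
  have hKQ : K ⊆ Q := fun x hx i => by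
    have := hR hx
    rw [mem_closedBall_zero_iff] at this
    exact (PiLp.norm_apply_le x i).trans this
  refine (euclideanHausdorffMeasure_frontier_mono hK.isClosed hconv hint hQ hKQ d).trans_lt ?_
  -- the faces of the cube are isometric images of a bounded set
  let B : Set (EuclideanSpace ℝ (Fin d)) := {x | ∀ i, |x i| ≤ R}
  let F : Fin (d + 1) → ℝ → EuclideanSpace ℝ (Fin d) → EuclideanSpace ℝ (Fin (d + 1)) :=
    fun i t x => WithLp.toLp 2 (i.insertNth t x.ofLp)
  have hF : ∀ i t, Isometry (F i t) := fun i t => by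
    refine Isometry.of_dist_eq fun x y => ?_
    rw [EuclideanSpace.dist_eq, EuclideanSpace.dist_eq, Fin.sum_univ_succAbove _ i]
    simp [F]
  have hcov : frontier Q ⊆ ⋃ i : Fin (d + 1), (F i R '' B ∪ F i (-R) '' B) := by
    intro x hx
    rw [hQc.frontier_eq] at hx
    obtain ⟨i, hi⟩ : ∃ i, R ≤ |x i| := by
      by_contra hcon
      push Not at hcon
      apply hx.2
      rw [mem_interior]
      refine ⟨{y | ∀ i, |y i| < R}, fun y hy i => (hy i).le, ?_, hcon⟩
      have : {y : EuclideanSpace ℝ (Fin (d + 1)) | ∀ i, |y i| < R} = ⋂ i, {y | |y i| < R} := by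
        ext; simp
      rw [this]
      exact isOpen_iInter_of_finite fun i => isOpen_lt (by fun_prop) continuous_const
    have hix : |x i| = R := le_antisymm (hx.1 i) hi
    have hrem : WithLp.toLp 2 (i.removeNth x.ofLp) ∈ B := fun j => by
      simpa [Fin.removeNth] using hx.1 _
    refine Set.mem_iUnion.2 ⟨i, ?_⟩
    rcases eq_or_eq_neg_of_abs_eq hix with h | h
    · left
      refine ⟨_, hrem, ?_⟩
      simp only [F, ← h]
      rw [Fin.insertNth_self_removeNth]
    · right
      refine ⟨_, hrem, ?_⟩
      simp only [F, ← h]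
      rw [Fin.insertNth_self_removeNth]
  have hB : volume B < ⊤ := by
    have hBb : B ⊆ Metric.closedBall 0 (Real.sqrt (∑ _i : Fin d, R ^ 2)) := by
      intro x hx
      rw [mem_closedBall_zero_iff, EuclideanSpace.norm_eq]
      refine Real.sqrt_le_sqrt (Finset.sum_le_sum fun i _ => ?_)
      rw [Real.norm_eq_abs]
      exact pow_le_pow_left₀ (abs_nonneg _) (hx i) 2
    exact (measure_mono hBb).trans_lt measure_closedBall_lt_top
  refine (measure_mono hcov).trans_lt ((measure_iUnion_fintype_le _ _).trans_lt ?_)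
  refine ENNReal.sum_lt_top.2 fun i _ => (measure_union_le _ _).trans_lt ?_
  rw [(hF i R).euclideanHausdorffMeasure_image, (hF i (-R)).euclideanHausdorffMeasure_image,
    EuclideanSpace.euclideanHausdorffMeasure_eq_volume]
  exact ENNReal.add_lt_top.2 ⟨hB, hB⟩

end HausdorffMeasure

/-! ### Counting lattice points on and through the facets -/

section FacetCount

variable {d : ℕ} {ι : Type*} [Fintype ι] {a : ι → EuclideanSpace ℝ (Fin (d + 1))} {h : ι → ℝ}

theorem convex_simplexOf (w : Fin (d + 1) → EuclideanSpace ℝ (Fin (d + 1))) :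
    Convex ℝ (simplexOf w) := by
  rintro _ ⟨l, hl0, hl1, rfl⟩ _ ⟨m, hm0, hm1, rfl⟩ p q hp hq hpq
  refine ⟨fun i => p * l i + q * m i,
    fun i => add_nonneg (mul_nonneg hp (hl0 i)) (mul_nonneg hq (hm0 i)), ?_, ?_⟩
  · rw [Finset.sum_add_distrib, ← Finset.mul_sum, ← Finset.mul_sum]
    nlinarith
  · simp only [add_smul, Finset.sum_add_distrib, mul_smul, ← Finset.smul_sum, smul_add]
    nth_rewrite 3 [← one_smul ℝ (w 0)]
    rw [← hpq]
    module

/-- A facet is the simplex of an enumeration of its vertices. -/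
theorem IsFacet.exists_vertices {s : Finset ι} (hs : IsFacet a h s) :
    ∃ w : Fin (d + 1) → ι, (∀ i, i ∈ s ↔ ∃ k, w k = i) ∧ LinearIndependent ℝ (edges (a ∘ w)) ∧
      cell a s = simplexOf (a ∘ w) := by
  have hcard : s.card = d + 1 := by rw [hs.card, finrank_euclideanSpace_fin]
  let e := (s.equivFinOfCardEq hcard).symm
  let w : Fin (d + 1) → ι := fun k => (e k).1
  have hinj : Function.Injective w := Subtype.val_injective.comp e.injective
  have hmem : ∀ k, w k ∈ s := fun k => (e k).2
  have hsurj : ∀ i, i ∈ s ↔ ∃ k, w k = i := fun i =>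
    ⟨fun hi => ⟨e.symm ⟨i, hi⟩, by simp [w]⟩, by rintro ⟨k, rfl⟩; exact hmem k⟩
  refine ⟨w, hsurj, ?_, ?_⟩
  · exact hs.indep.linearIndependent (hmem 0) (w := fun k : Fin d => w k.succ)
      (hinj.comp (Fin.succ_injective d)) (fun k => hmem _)
      (fun k hk => Fin.succ_ne_zero k (hinj hk))
  · apply Set.Subset.antisymm
    · refine cell_subset_of_convex (convex_simplexOf _) fun i hi => ?_
      obtain ⟨k, rfl⟩ := (hsurj i).1 hi
      refine Fin.cases ?_ (fun k => ?_) k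
      · exact ⟨0, by simp, by simp, by simp⟩
      · classical
        refine ⟨Pi.single k 1, fun i => ?_, by simp, ?_⟩
        · by_cases hik : i = k
          · subst hik; simp
          · simp [hik]
        · rw [Finset.sum_eq_single k]
          · simp [edges]
          · intro j _ hj; simp [hj]
          · simp
    · rintro _ ⟨l, hl0, hl1, rfl⟩
      have := (convex_cell a s).sum_mem (t := Finset.univ)
        (w := (Fin.cons (1 - ∑ i, l i) l : Fin (d + 1) → ℝ)) (z := a ∘ w) (fun i _ => by
          refine Fin.cases ?_ (fun i => ?_) i
          · simpa using hl1
          · simpa using hl0 i)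
        (by rw [Fin.sum_univ_succ]; simp) (fun i _ => mem_cell_of_mem a (hmem i))
      convert this using 1
      rw [Fin.sum_univ_succ]
      simp only [Fin.cons_zero, Fin.cons_succ, edges, smul_sub, Finset.sum_sub_distrib,
        ← Finset.sum_smul, sub_smul, one_smul]
      abel

/-- The facets of the triangulation. -/
noncomputable def facets (a : ι → EuclideanSpace ℝ (Fin (d + 1))) (h : ι → ℝ) :
    Finset (Finset ι) := by
  classical exact Finset.univ.filter fun s => IsFacet a h s

theorem mem_facets {s : Finset ι} : s ∈ facets a h ↔ IsFacet a h s := by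
  classical simp [facets]

/-- The number of vertices is at most the number of facets. -/
theorem card_le_card_facets (hg : GenericHeights a h)
    (hint : (interior (cell a Finset.univ)).Nonempty) (ha : Function.Injective a)
    (hext : ∀ i, a i ∈ (cell a Finset.univ).extremePoints ℝ) :
    Fintype.card ι ≤ (facets a h).card := by
  classical
  -- An extreme point of the polytope that lies in a cell is one of the points spanning the cell.
  have hmem : ∀ (i : ι) (s : Finset ι), a i ∈ cell a s → i ∈ s := by
    intro i s hi
    have h1 : a i ∈ (cell a s).extremePoints ℝ :=
      inter_extremePoints_subset_extremePoints_of_subset (cell_mono (Finset.subset_univ s))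
        ⟨hi, hext i⟩
    rw [cell_eq_convexHull] at h1
    obtain ⟨j, hj, hji⟩ := extremePoints_convexHull_subset h1
    exact ha hji ▸ hj
  -- Double counting of incidences: at least `d + 1` facets at each vertex, at most `d + 1` vertices
  -- on each facet.
  have := Finset.card_mul_le_card_mul (s := (Finset.univ : Finset ι)) (t := facets a h)
    (fun i s => i ∈ s) (m := d + 1) (n := d + 1) ?_ ?_
  · rw [Finset.card_univ] at this
    exact Nat.le_of_mul_le_mul_right this (Nat.succ_pos d)
  · intro i _
    have := finrank_le_card_facets hg hint (hext i)
      (Finset.bipartiteAbove (fun i s => i ∈ s) (facets a h) i) ?_ ?_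
    · rwa [finrank_euclideanSpace_fin] at this
    · intro s hs his
      exact Finset.mem_filter.2 ⟨mem_facets.2 hs, hmem i s his⟩
    · intro s hs
      exact mem_facets.1 (Finset.mem_filter.1 hs).1
  · intro s hs
    have h1 := (mem_facets.1 hs).card
    rw [finrank_euclideanSpace_fin] at h1
    rw [← h1]
    exact Finset.card_le_card fun i hi => (Finset.mem_filter.1 hi).2

/-- The norm of the edge normal of a facet, that is `d!` times its area. -/
noncomputable def facetWeight (a : ι → EuclideanSpace ℝ (Fin (d + 1))) (h : ι → ℝ)
    (s : Finset ι) : ℝ := by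
  classical exact
    if hs : IsFacet a h s then ‖edgeNormal (edges (a ∘ hs.exists_vertices.choose))‖ else 0

/-- The form of the edges of a facet. -/
noncomputable def facetForm (a : ι → EuclideanSpace ℝ (Fin (d + 1))) (h : ι → ℝ)
    (s : Finset ι) : EuclideanSpace ℝ (Fin (d + 1)) →ₗ[ℝ] ℝ := by
  classical exact
    if hs : IsFacet a h s then edgeForm (edges (a ∘ hs.exists_vertices.choose)) else 0

/-- The vertices that define `facetWeight` and `facetForm`. -/
theorem IsFacet.exists_vertices_weight {s : Finset ι} (hs : IsFacet a h s) :
    ∃ w : Fin (d + 1) → ι, (∀ i, i ∈ s ↔ ∃ k, w k = i) ∧ LinearIndependent ℝ (edges (a ∘ w)) ∧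
      cell a s = simplexOf (a ∘ w) ∧ facetWeight a h s = ‖edgeNormal (edges (a ∘ w))‖ ∧
      facetForm a h s = edgeForm (edges (a ∘ w)) := by
  obtain ⟨h1, h2, h3⟩ := hs.exists_vertices.choose_spec
  exact ⟨_, h1, h2, h3, by rw [facetWeight, dif_pos hs], by rw [facetForm, dif_pos hs]⟩

theorem one_le_facetWeight (hZ : ∀ i, a i ∈ integerLattice (d + 1)) {s : Finset ι}
    (hs : IsFacet a h s) : 1 ≤ facetWeight a h s := by
  obtain ⟨w, -, hli, -, hwt, -⟩ := hs.exists_vertices_weight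
  obtain ⟨b, -, -, h1, h2, -⟩ := exists_generator hli
    fun i => integerLattice_sub (hZ (w i.succ)) (hZ (w 0))
  rw [hwt]
  exact h2.trans h1

/-- The lattice points on the facets. -/
theorem card_boundary_le (hg : GenericHeights a h)
    (hint : (interior (cell a Finset.univ)).Nonempty) (ha : Function.Injective a)
    (hext : ∀ i, a i ∈ (cell a Finset.univ).extremePoints ℝ)
    (hZ : ∀ i, a i ∈ integerLattice (d + 1)) (S : Finset (EuclideanSpace ℝ (Fin (d + 1))))
    (hS : ∀ z ∈ S, z ∈ integerLattice (d + 1)) (hSb : ∀ z ∈ S, ∃ s, IsFacet a h s ∧ z ∈ cell a s) :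
    (S.card : ℝ) ≤ ∑ s ∈ facets a h, facetWeight a h s := by
  classical
  let C : Finset ι → Finset (EuclideanSpace ℝ (Fin (d + 1))) := fun s =>
    S.filter fun z => z ∈ cell a s ∧ z ∉ a '' s
  -- The half-open parallelotope at `a (w 0)` contains these points and also the vertex `a (w 0)`,
  -- which accounts for the `- 1`. The units saved pay for the vertices of the polytope.
  have hC : ∀ s ∈ facets a h, ((C s).card : ℝ) ≤ facetWeight a h s - 1 := by
    intro s hs
    obtain ⟨w, hw, hli, hcell, hwt, -⟩ := (mem_facets.1 hs).exists_vertices_weight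
    have hmZ : ∀ i, edges (a ∘ w) i ∈ integerLattice (d + 1) :=
      fun i => integerLattice_sub (hZ (w i.succ)) (hZ (w 0))
    obtain ⟨b, hb, hb0, hle, -, -⟩ := exists_generator hli hmZ
    have hnot : a (w 0) ∉ C s := fun hmem =>
      (Finset.mem_filter.1 hmem).2.2 ⟨w 0, (hw _).2 ⟨0, rfl⟩, rfl⟩
    have := card_le_abs_edgeForm hli hmZ hb hb0 (insert (a (w 0)) (C s)) ?_ (a (w 0)) ?_
    · rw [Finset.card_insert_of_notMem hnot, Nat.cast_add, Nat.cast_one] at this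
      rw [hwt]
      linarith
    · intro z hz
      rcases Finset.mem_insert.1 hz with rfl | hz
      · exact hZ _
      · exact hS z (Finset.mem_filter.1 hz).1
    · intro z hz
      rcases Finset.mem_insert.1 hz with rfl | hz
      · exact ⟨0, by simp, by simp⟩
      · obtain ⟨-, hz1, hz2⟩ := Finset.mem_filter.1 hz
        rw [hcell] at hz1
        exact exists_coord_of_mem_simplexOf hz1 fun i hi =>
          hz2 ⟨w i.succ, (hw _).2 ⟨_, rfl⟩, hi.symm⟩
  have hsub : S ⊆ (Finset.univ.image a) ∪ (facets a h).biUnion C := by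
    intro z hz
    obtain ⟨s, hs, hzs⟩ := hSb z hz
    rw [Finset.mem_union]
    by_cases hza : z ∈ a '' s
    · left
      obtain ⟨i, -, rfl⟩ := hza
      exact Finset.mem_image_of_mem a (Finset.mem_univ i)
    · right
      exact Finset.mem_biUnion.2 ⟨s, mem_facets.2 hs, Finset.mem_filter.2 ⟨hz, hzs, hza⟩⟩
  have h1 : S.card ≤ (facets a h).card + ∑ s ∈ facets a h, (C s).card :=
    calc S.card ≤ _ := Finset.card_le_card hsub
      _ ≤ _ := Finset.card_union_le _ _
      _ ≤ _ := add_le_add (Finset.card_image_le.trans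
        (by rw [Finset.card_univ]; exact card_le_card_facets hg hint ha hext)) Finset.card_biUnion_le
  calc (S.card : ℝ) ≤ ((facets a h).card + ∑ s ∈ facets a h, (C s).card : ℕ) := by
        exact_mod_cast h1
    _ = (facets a h).card + ∑ s ∈ facets a h, ((C s).card : ℝ) := by push_cast; rfl
    _ ≤ (facets a h).card + ∑ s ∈ facets a h, (facetWeight a h s - 1) := by
        gcongr with s hs; exact hC s hs
    _ = _ := by simp

/-- A functional supporting a facet. -/
noncomputable def facetFunctional (a : ι → EuclideanSpace ℝ (Fin (d + 1))) (h : ι → ℝ)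
    (s : Finset ι) : EuclideanSpace ℝ (Fin (d + 1)) →L[ℝ] ℝ := by
  classical exact if hs : IsFacet a h s then hs.supp.choose else 0

theorem IsFacet.supports {s : Finset ι} (hs : IsFacet a h s) :
    Supports a s (facetFunctional a h s) := by
  rw [facetFunctional, dif_pos hs]
  exact hs.supp.choose_spec

/-- A point of the polytope whose translate by `c` is outside lies on a facet or reaches one along a
proper part of `c`, and `c` crosses this facet outwards. -/
theorem exists_facet_of_add_notMem (hg : GenericHeights a h)
    (hint : (interior (cell a Finset.univ)).Nonempty) {z c : EuclideanSpace ℝ (Fin (d + 1))}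
    (hz : z ∈ cell a Finset.univ) (hzc : z + c ∉ cell a Finset.univ) :
    ∃ s, IsFacet a h s ∧ ∃ t ∈ Set.Ico (0 : ℝ) 1, z + t • c ∈ cell a s ∧
      0 < facetFunctional a h s c := by
  obtain ⟨t, ht, htP, hlast⟩ := exists_last_mem (isCompact_cell a Finset.univ).isClosed zero_le_one
    hz (by rwa [one_smul])
  obtain ⟨s, hs, hzs, hpos⟩ := exists_isFacet_of_exit hg hint htP (c := c) (fun e he hmem => by
    rcases le_total (t + e) 1 with h1 | h1
    · refine hlast (t + e) (by linarith) h1 ?_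
      rwa [add_smul, ← add_assoc]
    · refine hzc ?_
      -- If the ray were still inside beyond time 1, convexity would put `z + c` inside.
      have h2 := (convex_cell a Finset.univ).add_smul_sub_mem htP hmem (t := (1 - t) / e)
        ⟨div_nonneg (by linarith [ht.2]) he.le, by rw [div_le_one he]; linarith⟩
      convert h2 using 1
      rw [add_sub_cancel_left, smul_smul, div_mul_cancel₀ _ he.ne']
      module)
  exact ⟨s, hs, t, ht, hzs, hpos _ hs.supports⟩

/-- The lattice points of the polytope that leave it under translation by a generic vector. -/
theorem card_leaving_le (hg : GenericHeights a h)
    (hint : (interior (cell a Finset.univ)).Nonempty) (ha : Function.Injective a)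
    (hext : ∀ i, a i ∈ (cell a Finset.univ).extremePoints ℝ)
    (hZ : ∀ i, a i ∈ integerLattice (d + 1)) {c : EuclideanSpace ℝ (Fin (d + 1))}
    (hc : ∀ s, IsFacet a h s → facetForm a h s c ≠ 0)
    (hc' : ∀ t ∈ Set.Ioo (0 : ℝ) 1, t • c ∉ integerLattice (d + 1))
    (S : Finset (EuclideanSpace ℝ (Fin (d + 1))))
    (hS : ∀ z ∈ S, z ∈ integerLattice (d + 1)) (hSP : ∀ z ∈ S, z ∈ cell a Finset.univ)
    (hSc : ∀ z ∈ S, z + c ∉ cell a Finset.univ) :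
    (S.card : ℝ) ≤ ∑ s ∈ facets a h, facetWeight a h s +
      ∑ s ∈ facets a h, {x | 0 < facetFunctional a h s x}.indicator (fun x => |facetForm a h s x|) c := by
  classical
  -- `B` collects the points that exit at time 0, `D s` those that cross `s` outwards at a positive
  -- time.
  let B := S.filter fun z => ∃ s, IsFacet a h s ∧ z ∈ cell a s
  let D : Finset ι → Finset (EuclideanSpace ℝ (Fin (d + 1))) := fun s =>
    S.filter fun z => ∃ t ∈ Set.Ioo (0 : ℝ) 1, z + t • c ∈ cell a s ∧ 0 < facetFunctional a h s c
  have hB : (B.card : ℝ) ≤ ∑ s ∈ facets a h, facetWeight a h s :=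
    card_boundary_le hg hint ha hext hZ B (fun z hz => hS z (Finset.mem_filter.1 hz).1)
      fun z hz => (Finset.mem_filter.1 hz).2
  have hD : ∀ s ∈ facets a h, ((D s).card : ℝ) ≤
      {x | 0 < facetFunctional a h s x}.indicator (fun x => |facetForm a h s x|) c := by
    intro s hs
    by_cases hpos : 0 < facetFunctional a h s c
    · rw [Set.indicator_of_mem (by exact hpos)]
      have hf := hc s (mem_facets.1 hs)
      obtain ⟨w, hw, hli, hcell, -, hform⟩ := (mem_facets.1 hs).exists_vertices_weight
      rw [hform] at hf ⊢
      refine card_sweep_le (fun i => hZ _) hli hf (D s)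
        (fun z hz => hS z (Finset.mem_filter.1 hz).1) fun z hz => ?_
      obtain ⟨hzS, t, ht, h1, -⟩ := Finset.mem_filter.1 hz
      -- Hitting a vertex would make `t • c` a difference of lattice points, which genericity of `c`
      -- forbids.
      refine ⟨t, ht, hcell ▸ h1, fun i hi => hc' t ht ?_⟩
      rw [← eq_sub_iff_add_eq'] at hi
      rw [hi]
      exact integerLattice_sub (hZ _) (hS z hzS)
    · rw [Set.indicator_of_notMem (by exact hpos)]
      have : D s = ∅ := Finset.filter_eq_empty_iff.2 fun z _ hcon => by
        obtain ⟨t, -, -, h2⟩ := hcon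
        exact hpos h2
      simp [this]
  have hsub : S ⊆ B ∪ (facets a h).biUnion D := by
    intro z hz
    obtain ⟨s, hs, t, ht, hmem, hpos⟩ := exists_facet_of_add_notMem hg hint (hSP z hz) (hSc z hz)
    rw [Finset.mem_union]
    rcases ht.1.eq_or_lt with h0 | h0
    · left
      refine Finset.mem_filter.2 ⟨hz, s, hs, ?_⟩
      rwa [← h0, zero_smul, add_zero] at hmem
    · right
      exact Finset.mem_biUnion.2 ⟨s, mem_facets.2 hs,
        Finset.mem_filter.2 ⟨hz, t, ⟨h0, ht.2⟩, hmem, hpos⟩⟩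
  have h1 : S.card ≤ B.card + ∑ s ∈ facets a h, (D s).card :=
    calc S.card ≤ _ := Finset.card_le_card hsub
      _ ≤ _ := Finset.card_union_le _ _
      _ ≤ _ := add_le_add le_rfl Finset.card_biUnion_le
  calc (S.card : ℝ) ≤ (B.card + ∑ s ∈ facets a h, (D s).card : ℕ) := by exact_mod_cast h1
    _ = B.card + ∑ s ∈ facets a h, ((D s).card : ℝ) := by push_cast; rfl
    _ ≤ _ := add_le_add hB (Finset.sum_le_sum hD)

/-- The areas of the facets add up to at most the surface area. -/
theorem sum_facetWeight_le (hg : GenericHeights a h) :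
    ENNReal.ofReal ((∑ s ∈ facets a h, facetWeight a h s) * (1 / d.factorial)) ≤
      (Measure.euclideanHausdorffMeasure d : Measure (EuclideanSpace ℝ (Fin (d + 1))))
        (frontier (cell a Finset.univ)) := by
  classical
  have hwt : ∀ s ∈ facets a h, 0 ≤ facetWeight a h s * (1 / d.factorial) ∧
      ENNReal.ofReal (facetWeight a h s * (1 / d.factorial)) ≤
      (Measure.euclideanHausdorffMeasure d : Measure (EuclideanSpace ℝ (Fin (d + 1))))
        (cell a s) := by
    intro s hs
    obtain ⟨w, -, hli, hcell, hwt, -⟩ := (mem_facets.1 hs).exists_vertices_weight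
    rw [hwt, hcell]
    exact ⟨by positivity, edgeNormal_le_area hli⟩
  rw [Finset.sum_mul, ENNReal.ofReal_sum_of_nonneg fun s hs => (hwt s hs).1]
  refine (Finset.sum_le_sum fun s hs => (hwt s hs).2).trans ?_
  -- Distinct facets share fewer than `d + 1` vertices, so their overlaps are null and their areas
  -- add up inside the frontier.
  rw [← measure_biUnion_finset₀]
  · exact measure_mono (Set.iUnion₂_subset fun s hs => (mem_facets.1 hs).cell_subset_frontier)
  · intro s hs t ht hst
    have hs' := mem_facets.1 (Finset.mem_coe.1 hs)
    have ht' := mem_facets.1 (Finset.mem_coe.1 ht)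
    refine measure_mono_null (cell_inter_subset hg hs'.opt ht'.opt)
      (euclideanHausdorffMeasure_cell_eq_zero a ?_)
    have h1 := hs'.card
    have h2 := ht'.card
    rw [finrank_euclideanSpace_fin] at h1 h2
    have h3 : (s ∩ t).card < s.card := Finset.card_lt_card <| by
      refine Finset.ssubset_iff_subset_ne.2 ⟨Finset.inter_subset_left, fun heq => hst ?_⟩
      exact Finset.eq_of_subset_of_card_le (Finset.inter_eq_left.1 heq) (by omega)
    omega
  · exact fun s _ => (isCompact_cell a s).measurableSet.nullMeasurableSet

end FacetCount

/-! ### Averaging over the unit cube -/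

section Averaging

variable {n : ℕ}

instance isProbabilityMeasure_unitCube :
    IsProbabilityMeasure ((volume : Measure (EuclideanSpace ℝ (Fin n))).restrict (unitCube n)) :=
  ⟨by rw [Measure.restrict_apply_univ, volume_unitCube]⟩

theorem abs_le_of_mem_unitCube {x : EuclideanSpace ℝ (Fin n)} (hx : x ∈ unitCube n) (j : Fin n) :
    |x j| ≤ 1 / 2 := by
  have := hx j
  exact abs_le.2 ⟨by linarith [this.1], this.2.le⟩

theorem integral_abs_coord_unitCube (j : Fin n) : ∫ c in unitCube n, |c j| = 1 / 4 := by
  have h1 : ∫ c in unitCube n, |c j| =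
      ∫ c in Set.univ.pi fun _ : Fin n => Set.Ioo (-1 / 2 : ℝ) (1 / 2), |c j| := by
    rw [unitCube_eq_preimage]
    exact (PiLp.volume_preserving_ofLp (Fin n)).setIntegral_preimage_emb
      (MeasurableEquiv.toLp 2 (Fin n → ℝ)).symm.measurableEmbedding (fun c => |c j|) _
  have hprob : IsProbabilityMeasure ((volume : Measure ℝ).restrict (Set.Ioo (-1 / 2) (1 / 2))) :=
    ⟨by rw [Measure.restrict_apply_univ, Real.volume_Ioo]; norm_num⟩
  rw [h1, volume_pi, Measure.restrict_pi_pi]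
  have h2 := (measurePreserving_eval
    (fun _ : Fin n => (volume : Measure ℝ).restrict (Set.Ioo (-1 / 2) (1 / 2))) j)
  have h3 := integral_map (μ := Measure.pi
    (fun _ : Fin n => (volume : Measure ℝ).restrict (Set.Ioo (-1 / 2) (1 / 2))))
    h2.measurable.aemeasurable (f := fun t : ℝ => |t|) (by fun_prop)
  rw [h2.map_eq] at h3
  have h4 : ∫ t in Set.Ioo (-1 / 2 : ℝ) (1 / 2), |t| = 1 / 4 := by
    rw [← integral_Ioc_eq_integral_Ioo, ← intervalIntegral.integral_of_le (by norm_num),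
      ← intervalIntegral.integral_add_adjacent_intervals (b := 0)
        (continuous_abs.intervalIntegrable _ _) (continuous_abs.intervalIntegrable _ _),
      intervalIntegral.integral_congr (g := fun t => -t) (a := -1 / 2) (b := 0),
      intervalIntegral.integral_congr (g := fun t => t) (a := 0) (b := 1 / 2)]
    · rw [intervalIntegral.integral_neg, integral_id, integral_id]
      norm_num
    · intro t ht
      rw [Set.uIcc_of_le (by norm_num)] at ht
      exact abs_of_nonneg ht.1
    · intro t ht
      rw [Set.uIcc_of_le (by norm_num)] at ht
      exact abs_of_nonpos ht.2
  rw [← h4, h3]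

theorem neg_mem_unitCube {x : EuclideanSpace ℝ (Fin n)} : -x ∈ unitCube n ↔ x ∈ unitCube n := by
  refine forall_congr' fun i => ?_
  simp only [PiLp.neg_apply, Set.mem_Ioo]
  constructor <;> rintro ⟨h1, h2⟩ <;> constructor <;> linarith

theorem integral_comp_neg_unitCube (f : EuclideanSpace ℝ (Fin n) → ℝ) :
    ∫ c in unitCube n, f (-c) = ∫ c in unitCube n, f c := by
  rw [← integral_indicator measurableSet_unitCube, ← integral_indicator measurableSet_unitCube,
    ← integral_neg_eq_self]
  refine integral_congr_ae (Filter.Eventually.of_forall fun c => ?_)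
  by_cases h : c ∈ unitCube n
  · simp [Set.indicator, h, neg_mem_unitCube]
  · simp [Set.indicator, h, neg_mem_unitCube]

theorem integrableOn_unitCube_of_bound {f : EuclideanSpace ℝ (Fin n) → ℝ} (hf : Measurable f)
    (C : ℝ) (hC : ∀ c ∈ unitCube n, |f c| ≤ C) : IntegrableOn f (unitCube n) :=
  Integrable.of_bound hf.aestronglyMeasurable C
    ((ae_restrict_iff' measurableSet_unitCube).2 (Filter.Eventually.of_forall hC))

theorem abs_sum_mul_le {x g : EuclideanSpace ℝ (Fin n)} (hx : x ∈ unitCube n) :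
    |∑ j, x j * g j| ≤ ∑ j, |g j| :=
  (Finset.abs_sum_le_sum_abs _ _).trans (Finset.sum_le_sum fun j _ => by
    rw [abs_mul]
    nlinarith [abs_le_of_mem_unitCube hx j, abs_nonneg (g j)])

theorem integrableOn_halfspace_abs (g : EuclideanSpace ℝ (Fin n))
    (f : EuclideanSpace ℝ (Fin n) →L[ℝ] ℝ) :
    IntegrableOn ({x | 0 < f x}.indicator fun x => |∑ j, x j * g j|) (unitCube n) := by
  refine integrableOn_unitCube_of_bound (Measurable.indicator (by fun_prop)
    (isOpen_lt continuous_const f.continuous).measurableSet) (∑ j, |g j|) fun c hc => ?_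
  by_cases h : 0 < f c
  · rw [Set.indicator_of_mem (by exact h), abs_abs]
    exact abs_sum_mul_le hc
  · rw [Set.indicator_of_notMem (by exact h), abs_zero]
    exact Finset.sum_nonneg fun j _ => abs_nonneg _

/-- The average over the unit cube of the absolute value of a linear form on a half-space. -/
theorem integral_halfspace_abs_le (g : EuclideanSpace ℝ (Fin n))
    (f : EuclideanSpace ℝ (Fin n) →L[ℝ] ℝ) :
    ∫ c in unitCube n, {x | 0 < f x}.indicator (fun x => |∑ j, x j * g j|) c ≤
      Real.sqrt n / 8 * ‖g‖ := by
  set F : EuclideanSpace ℝ (Fin n) → ℝ := {x | 0 < f x}.indicator fun x => |∑ j, x j * g j| with hF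
  have hint := integrableOn_halfspace_abs g f
  have hint' : IntegrableOn (fun c => F (-c)) (unitCube n) := by
    have := integrableOn_halfspace_abs (-g) (-f)
    refine this.congr (Filter.Eventually.of_forall fun c => ?_)
    simp [hF, Set.indicator, Finset.sum_neg_distrib]
  have habs : ∀ j, IntegrableOn (fun c : EuclideanSpace ℝ (Fin n) => |c j| * |g j|) (unitCube n) :=
    fun j => (integrableOn_unitCube_of_bound (f := fun c => |c j|) (by fun_prop) (1 / 2)
      fun c hc => by rw [abs_abs]; exact abs_le_of_mem_unitCube hc j).mul_const _
  -- At most one of `c` and `-c` lies in the open half-space, so `F c + F (-c)` is at most the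
  -- absolute value of the form. The final constant is 1/2 from this symmetry, 1/4 from the mean of
  -- `|c j|`, and `√n` from Cauchy–Schwarz.
  have h1 : 2 * ∫ c in unitCube n, F c ≤ ∫ c in unitCube n, ∑ j, |c j| * |g j| := by
    rw [two_mul]
    nth_rewrite 2 [← integral_comp_neg_unitCube]
    rw [← integral_add hint hint']
    refine integral_mono (hint.add hint') (integrable_finsetSum _ fun j _ => habs j) fun c => ?_
    have h2 : |∑ j, c j * g j| ≤ ∑ j, |c j| * |g j| :=
      (Finset.abs_sum_le_sum_abs _ _).trans_eq (by simp only [abs_mul])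
    refine le_trans ?_ h2
    have hneg : |∑ j, (-c) j * g j| = |∑ j, c j * g j| := by
      rw [← abs_neg]; simp [Finset.sum_neg_distrib]
    simp only [hF, Set.indicator, Set.mem_ofPred_eq, map_neg, hneg]
    split_ifs with p q
    · linarith
    · simp
    · simp
    · simp
  rw [integral_finsetSum _ fun j _ => habs j] at h1
  simp only [integral_mul_const, integral_abs_coord_unitCube, ← Finset.mul_sum] at h1
  have h3 : ∑ j, |g j| ≤ Real.sqrt n * ‖g‖ := by
    have := sq_sum_le_card_mul_sum_sq (s := Finset.univ) (f := fun j => |g j|)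
    rw [Finset.card_univ, Fintype.card_fin] at this
    rw [EuclideanSpace.norm_eq, ← Real.sqrt_mul (Nat.cast_nonneg n)]
    exact Real.le_sqrt_of_sq_le (by simpa using this)
  linarith

/-- The parts of a set in the unit cubes around distinct lattice points are disjoint. -/
theorem sum_integral_indicator_le {P : Set (EuclideanSpace ℝ (Fin n))} (hP : MeasurableSet P)
    (hfin : volume P < ⊤) (S : Finset (EuclideanSpace ℝ (Fin n)))
    (hS : ∀ z ∈ S, z ∈ integerLattice n) :
    ∑ z ∈ S, ∫ c in unitCube n, P.indicator (fun _ => (1 : ℝ)) (z + c) ≤ volume.real P := by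
  have h1 : ∀ z : EuclideanSpace ℝ (Fin n),
      ∫ c in unitCube n, P.indicator (fun _ => (1 : ℝ)) (z + c) =
        volume.real (P ∩ (fun x => z + x) '' unitCube n) := by
    intro z
    have hm : MeasurableSet ((fun c => z + c) ⁻¹' P) := hP.preimage (by fun_prop)
    have : (fun c => P.indicator (fun _ => (1 : ℝ)) (z + c)) =
        ((fun c => z + c) ⁻¹' P).indicator 1 := by
      funext c; rfl
    rw [this, integral_indicator_one hm, measureReal_restrict_apply hm, measureReal_def,
      measureReal_def, ← Set.image_preimage_inter, Set.image_add_left, measure_preimage_add]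
  simp only [h1]
  rw [← measureReal_biUnion_finset]
  · exact measureReal_mono (Set.iUnion₂_subset fun z _ => Set.inter_subset_left) hfin.ne
  · intro z hz z' hz' hne
    rw [Function.onFun, Set.disjoint_left]
    rintro _ ⟨-, u, hu, rfl⟩ ⟨-, u', hu', h⟩
    exact hne (eq_of_add_unitCube (hS z hz) (hS z' hz') hu hu' h.symm)
  · exact fun z _ => hP.inter ((MeasurableEquiv.addLeft z).measurableSet_image.2 measurableSet_unitCube)

/-- In dimension at least two almost no vector has a proper multiple in the lattice. -/
theorem ae_smul_notMem_integerLattice (hn : 2 ≤ n) :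
    ∀ᵐ c : EuclideanSpace ℝ (Fin n), ∀ t ∈ Set.Ioo (0 : ℝ) 1, t • c ∉ integerLattice n := by
  -- An exceptional `c` lies on a line spanned by a lattice vector; there are countably many such
  -- lines, each null when `n ≥ 2`.
  have hnull : volume (⋃ y ∈ integerLattice n,
      (Submodule.span ℝ {y} : Set (EuclideanSpace ℝ (Fin n)))) = 0 := by
    refine (measure_biUnion_null_iff countable_integerLattice).2 fun y _ => ?_
    refine Measure.addHaar_submodule _ _ fun htop => ?_
    have h1 := finrank_span_le_card (R := ℝ) ({y} : Set (EuclideanSpace ℝ (Fin n)))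
    rw [htop, finrank_top, finrank_euclideanSpace_fin] at h1
    simp at h1
    omega
  filter_upwards [measure_eq_zero_iff_ae_notMem.1 hnull] with c hc t ht hmem
  refine hc (Set.mem_iUnion₂.2 ⟨_, hmem, ?_⟩)
  refine Submodule.mem_span_singleton.2 ⟨t⁻¹, ?_⟩
  rw [smul_smul, inv_mul_cancel₀ ht.1.ne', one_smul]

theorem ae_linear_ne_zero {f : EuclideanSpace ℝ (Fin n) →ₗ[ℝ] ℝ} (hf : f ≠ 0) :
    ∀ᵐ c : EuclideanSpace ℝ (Fin n), f c ≠ 0 :=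
  measure_eq_zero_iff_ae_notMem.1
    (Measure.addHaar_submodule volume (LinearMap.ker f) fun h => hf (LinearMap.ker_eq_top.1 h))

/-- Averaging the number of lattice points that leave `P` under a translation by a vector of the
unit cube. -/
theorem card_le_volume_add {P : Set (EuclideanSpace ℝ (Fin n))} (hP : MeasurableSet P)
    (hfin : volume P < ⊤) (S : Finset (EuclideanSpace ℝ (Fin n)))
    (hS : ∀ z ∈ S, z ∈ integerLattice n) {F : EuclideanSpace ℝ (Fin n) → ℝ}
    (hF : IntegrableOn F (unitCube n))
    (hle : ∀ᵐ c, c ∈ unitCube n → ∀ S' ⊆ S, (∀ z ∈ S', z + c ∉ P) → (S'.card : ℝ) ≤ F c) :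
    (S.card : ℝ) ≤ volume.real P + ∫ c in unitCube n, F c := by
  classical
  have hint : ∀ z ∈ S, IntegrableOn (fun c => P.indicator (fun _ => (1 : ℝ)) (z + c))
      (unitCube n) := fun z _ =>
    integrableOn_unitCube_of_bound ((measurable_const.indicator hP).comp (by fun_prop)) 1
      fun c _ => by
        by_cases h : z + c ∈ P <;> simp [h]
  calc (S.card : ℝ) = ∫ _c in unitCube n, (S.card : ℝ) := by simp
    _ ≤ ∫ c in unitCube n, (∑ z ∈ S, P.indicator (fun _ => (1 : ℝ)) (z + c) + F c) := by
        refine integral_mono_ae (integrable_const _) ((integrable_finsetSum _ hint).add hF) ?_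
        refine (ae_restrict_iff' measurableSet_unitCube).2 ?_
        filter_upwards [hle] with c hc hmem
        -- For fixed `c`, the indicators count the points that stay and `F c` bounds those that
        -- leave.
        have h1 := hc hmem (S.filter fun z => z + c ∉ P) (Finset.filter_subset _ _)
          fun z hz => (Finset.mem_filter.1 hz).2
        have h2 : ∑ z ∈ S, P.indicator (fun _ => (1 : ℝ)) (z + c) =
            ((S.filter fun z => z + c ∈ P).card : ℝ) := by
          rw [Finset.card_filter, Nat.cast_sum]
          refine Finset.sum_congr rfl fun z _ => ?_
          by_cases h : z + c ∈ P <;> simp [h]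
        have h3 := Finset.card_filter_add_card_filter_not (s := S) fun z => z + c ∈ P
        rw [h2, ← h3]
        push_cast
        linarith
    _ = (∑ z ∈ S, ∫ c in unitCube n, P.indicator (fun _ => (1 : ℝ)) (z + c)) +
          ∫ c in unitCube n, F c := by
        rw [integral_add (integrable_finsetSum _ hint) hF, integral_finsetSum _ hint]
    _ ≤ _ := add_le_add (sum_integral_indicator_le hP hfin S hS) le_rfl

end Averaging

/-! ### Assembling the bound -/

section Main

variable {d : ℕ} {ι : Type*} [Fintype ι] {a : ι → EuclideanSpace ℝ (Fin (d + 1))} {h : ι → ℝ}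

/-- The lattice point bound for a lattice polytope in dimension at least two. -/
theorem card_le_volume_add_facetWeight (hd : 1 ≤ d) (hg : GenericHeights a h)
    (hint : (interior (cell a Finset.univ)).Nonempty) (ha : Function.Injective a)
    (hext : ∀ i, a i ∈ (cell a Finset.univ).extremePoints ℝ)
    (hZ : ∀ i, a i ∈ integerLattice (d + 1)) (S : Finset (EuclideanSpace ℝ (Fin (d + 1))))
    (hS : ∀ z ∈ S, z ∈ integerLattice (d + 1)) (hSP : ∀ z ∈ S, z ∈ cell a Finset.univ) :
    (S.card : ℝ) ≤ volume.real (cell a Finset.univ) +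
      (1 + Real.sqrt (d + 1 : ℕ) / 8) * ∑ s ∈ facets a h, facetWeight a h s := by
  have hPc := isCompact_cell a Finset.univ
  have hform : ∀ s ∈ facets a h, ∃ g : EuclideanSpace ℝ (Fin (d + 1)),
      ‖g‖ = facetWeight a h s ∧ (∀ c, facetForm a h s c = ∑ j, c j * g j) ∧
        facetForm a h s ≠ 0 := by
    intro s hs
    obtain ⟨w, -, hli, -, hwt, hf⟩ := (mem_facets.1 hs).exists_vertices_weight
    exact ⟨_, hwt.symm, fun c => by rw [hf, edgeForm_eq_sum], by rw [hf]; exact edgeForm_ne_zero hli⟩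
  have hFint : ∀ s ∈ facets a h, IntegrableOn ({x | 0 < facetFunctional a h s x}.indicator
      fun x => |facetForm a h s x|) (unitCube (d + 1)) := by
    intro s hs
    obtain ⟨g, -, hg2, -⟩ := hform s hs
    simp only [hg2]
    exact integrableOn_halfspace_abs g _
  have hFle : ∀ s ∈ facets a h, ∫ c in unitCube (d + 1), {x | 0 < facetFunctional a h s x}.indicator
      (fun x => |facetForm a h s x|) c ≤ Real.sqrt (d + 1 : ℕ) / 8 * facetWeight a h s := by
    intro s hs
    obtain ⟨g, hg1, hg2, -⟩ := hform s hs
    simp only [hg2, ← hg1]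
    exact integral_halfspace_abs_le g _
  have hsum := integrable_finsetSum (facets a h) hFint
  have hmain := card_le_volume_add hPc.measurableSet hPc.measure_lt_top S hS
    (F := fun c => ∑ s ∈ facets a h, facetWeight a h s + ∑ s ∈ facets a h,
      {x | 0 < facetFunctional a h s x}.indicator (fun x => |facetForm a h s x|) c)
    ((integrable_const _).add hsum) ?_
  · rw [integral_add (integrable_const _) hsum, integral_finsetSum _ hFint] at hmain
    have := Finset.sum_le_sum hFle
    rw [← Finset.mul_sum] at this
    simp only [integral_const, probReal_univ, one_smul] at hmain
    linarith
  · have hne : ∀ᵐ c : EuclideanSpace ℝ (Fin (d + 1)), ∀ s ∈ facets a h, facetForm a h s c ≠ 0 :=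
      (Finset.eventually_all _).2 fun s hs => ae_linear_ne_zero (hform s hs).choose_spec.2.2
    filter_upwards [hne, ae_smul_notMem_integerLattice (n := d + 1) (by omega)] with c hc hc' _ S' hS'
      hleave
    exact card_leaving_le hg hint ha hext hZ (fun s hs => hc s (mem_facets.2 hs)) hc' S'
      (fun z hz => hS z (hS' hz)) (fun z hz => hSP z (hS' hz)) hleave

/-- A lattice segment has at most one lattice point more than its length. -/
theorem card_le_volume_add_one {P : Set (EuclideanSpace ℝ (Fin 1))} (hP : IsCompact P)
    (hconv : Convex ℝ P) (S : Finset (EuclideanSpace ℝ (Fin 1)))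
    (hS : ∀ z ∈ S, z ∈ integerLattice 1) (hSP : ∀ z ∈ S, z ∈ P) :
    (S.card : ℝ) ≤ volume.real P + 1 := by
  -- Distinct lattice points are at distance at least 1, so a shift by less than 1/2 moves one of
  -- them towards the other and keeps it in `P`. Hence at most one point leaves.
  have hkey : ∀ c ∈ unitCube 1, ∀ z ∈ S, ∀ z' ∈ S, z + c ∉ P → z' + c ∉ P → ¬ z 0 < z' 0 := by
    intro c hc z hz z' hz' h1 h2 hlt
    obtain ⟨k, hk⟩ := hS z hz 0
    obtain ⟨k', hk'⟩ := hS z' hz' 0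
    have hone : z 0 + 1 ≤ z' 0 := by
      have hlt' : (k : ℝ) < k' := by rw [← hk, ← hk']; exact hlt
      have h3 : k + 1 ≤ k' := by exact_mod_cast hlt'
      have h4 : (k : ℝ) + 1 ≤ k' := by exact_mod_cast h3
      rwa [← hk, ← hk'] at h4
    have hpt : ∀ y : EuclideanSpace ℝ (Fin 1), z 0 ≤ y 0 → y 0 ≤ z' 0 → y ∈ P := by
      intro y hy1 hy2
      have hpos : 0 < z' 0 - z 0 := by linarith
      have := hconv.add_smul_sub_mem (hSP z hz) (hSP z' hz') (t := (y 0 - z 0) / (z' 0 - z 0))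
        ⟨div_nonneg (by linarith) hpos.le, by rw [div_le_one hpos]; linarith⟩
      convert this using 1
      ext i
      fin_cases i
      simp only [Fin.zero_eta, PiLp.add_apply, PiLp.smul_apply, PiLp.sub_apply, smul_eq_mul]
      field_simp
      ring
    have hc0 := hc 0
    rcases le_total 0 (c 0) with h0 | h0
    · exact h1 (hpt _ (by simpa using h0) (by simp only [PiLp.add_apply]; linarith [hc0.2]))
    · exact h2 (hpt _ (by simp only [PiLp.add_apply]; linarith [hc0.1]) (by simpa using h0))
  have := card_le_volume_add hP.measurableSet hP.measure_lt_top S hS (F := fun _ => 1)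
    (integrable_const _) (Filter.Eventually.of_forall fun c hc S' hS' hleave => ?_)
  · simpa using this
  · have : S'.card ≤ 1 := Finset.card_le_one.2 fun z hz z' hz' => by
      ext i
      fin_cases i
      exact le_antisymm (not_lt.1 (hkey c hc z' (hS' hz') z (hS' hz) (hleave _ hz') (hleave _ hz)))
        (not_lt.1 (hkey c hc z (hS' hz) z' (hS' hz') (hleave _ hz) (hleave _ hz')))
    exact_mod_cast this

end Main

/-- The convex hull of a finite set is the convex hull of its extreme points. -/
theorem exists_vertices_of_finite {d : ℕ} {W : Set (EuclideanSpace ℝ (Fin (d + 1)))}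
    (hW : W.Finite) :
    ∃ A : Finset (EuclideanSpace ℝ (Fin (d + 1))), (A : Set _) ⊆ W ∧
      cell (Subtype.val : A → EuclideanSpace ℝ (Fin (d + 1))) Finset.univ = convexHull ℝ W ∧
      ∀ i : A, i.1 ∈ (convexHull ℝ W).extremePoints ℝ := by
  have hsub : (convexHull ℝ W).extremePoints ℝ ⊆ W := extremePoints_convexHull_subset
  have hfin := hW.subset hsub
  refine ⟨hfin.toFinset, by simpa using hsub, ?_, fun i => hfin.mem_toFinset.1 i.2⟩
  rw [cell_eq_convexHull, Finset.coe_univ, Set.image_univ, Subtype.range_coe_subtype]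
  have h1 := closure_convexHull_extremePoints (hW.isCompact_convexHull (𝕜 := ℝ))
    (convex_convexHull ℝ W)
  rw [(hfin.isClosed_convexHull (𝕜 := ℝ)).closure_eq] at h1
  refine Eq.trans ?_ h1
  congr 1
  ext x
  exact hfin.mem_toFinset

theorem theorem1p1 (n : ℕ) (hn : 1 ≤ n) (K : ConvexBody (EuclideanSpace ℝ (Fin n)))
    (hK : ∃ p : Fin (n + 1) → EuclideanSpace ℝ (Fin n),
      AffineIndependent ℝ p ∧
        ∀ i, p i ∈ (K : Set (EuclideanSpace ℝ (Fin n))) ∩ integerLattice n) :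
    (latticePointCount (K : Set (EuclideanSpace ℝ (Fin n))) : ℝ) <
      (volume : Measure (EuclideanSpace ℝ (Fin n))).real (K : Set (EuclideanSpace ℝ (Fin n))) +
        (Real.sqrt (n : ℝ) + 1) / 2 * (Nat.factorial (n - 1) : ℝ) * surfaceArea K := by
  obtain ⟨d, rfl⟩ : ∃ d, n = d + 1 := ⟨n - 1, by omega⟩
  obtain ⟨p, hp, hpK⟩ := hK
  set W : Set (EuclideanSpace ℝ (Fin (d + 1))) := (K : Set _) ∩ integerLattice (d + 1) with hWdef
  have hWfin : W.Finite := by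
    have hb : Bornology.IsBounded (K : Set (EuclideanSpace ℝ (Fin (d + 1)))) := K.isCompact.isBounded
    refine (ZSpan.setFinite_inter (EuclideanSpace.basisFun (Fin (d + 1)) ℝ).toBasis hb).subset ?_
    rintro x ⟨hx, hxZ⟩
    refine ⟨hx, ?_⟩
    choose k hk using hxZ
    rw [← (EuclideanSpace.basisFun (Fin (d + 1)) ℝ).toBasis.sum_repr x]
    refine Submodule.sum_mem _ fun i _ => ?_
    have : (EuclideanSpace.basisFun (Fin (d + 1)) ℝ).toBasis.repr x i = k i := by simp [hk]
    rw [this, Int.cast_smul_eq_zsmul]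
    exact Submodule.smul_mem _ _ (Submodule.subset_span ⟨i, rfl⟩)
  obtain ⟨A, hAW, hcell, hext⟩ := exists_vertices_of_finite hWfin
  obtain ⟨h, hg⟩ := exists_genericHeights (Subtype.val : A → EuclideanSpace ℝ (Fin (d + 1)))
  set a : A → EuclideanSpace ℝ (Fin (d + 1)) := Subtype.val with hadef
  rw [← hcell] at hext
  have hWP : ∀ z ∈ W, z ∈ cell a Finset.univ := fun z hz => by
    rw [hcell]; exact subset_convexHull ℝ W hz
  have hint : (interior (cell a Finset.univ)).Nonempty := by
    rw [(convex_cell a _).interior_nonempty_iff_affineSpan_eq_top, eq_top_iff,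
      ← hp.affineSpan_eq_top_iff_card_eq_finrank_add_one.2 (by simp)]
    exact affineSpan_mono ℝ (by rintro _ ⟨i, rfl⟩; exact hWP _ (hpK i))
  have hPK : cell a Finset.univ ⊆ K := by
    rw [hcell]; exact convexHull_min Set.inter_subset_left K.convex
  have hcount : (latticePointCount (K : Set (EuclideanSpace ℝ (Fin (d + 1)))) : ℝ) =
      hWfin.toFinset.card := by
    rw [latticePointCount, ← hWdef, Set.ncard_eq_toFinset_card W hWfin]
  have hZ : ∀ i, a i ∈ integerLattice (d + 1) := fun i => (hAW i.2).2
  have hvol : volume.real (cell a Finset.univ) ≤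
      volume.real (K : Set (EuclideanSpace ℝ (Fin (d + 1)))) :=
    measureReal_mono hPK K.isCompact.measure_lt_top.ne
  set T := ∑ s ∈ facets a h, facetWeight a h s with hT
  have harea : T ≤ (d.factorial : ℝ) * surfaceArea K := by
    have h1 := (sum_facetWeight_le hg).trans (euclideanHausdorffMeasure_frontier_mono
      (isCompact_cell a _).isClosed (convex_cell a _) hint K.isCompact hPK d)
    rw [← hT, ENNReal.ofReal_le_iff_le_toReal (euclideanHausdorffMeasure_frontier_lt_top K.isCompact
      K.convex (hint.mono (interior_mono hPK))).ne] at h1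
    have h2 : T * (1 / d.factorial) ≤ surfaceArea K := h1
    have h3 : (0 : ℝ) < d.factorial := by exact_mod_cast d.factorial_pos
    rw [mul_one_div, div_le_iff₀ h3] at h2
    linarith
  have hcardT : (Fintype.card A : ℝ) ≤ T := by
    have h1 := card_le_card_facets hg hint Subtype.val_injective hext
    have h2 : ((facets a h).card : ℝ) ≤ T := by
      rw [← nsmul_one]
      exact Finset.card_nsmul_le_sum _ _ _ fun s hs => one_le_facetWeight hZ (mem_facets.1 hs)
    exact le_trans (by exact_mod_cast h1) h2
  -- A hull of at most one point has empty interior. The resulting `2 ≤ T` supplies strictness: it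
  -- beats the 1 in dimension one, and `T > 0` is what the other case needs.
  have hcardA : 2 ≤ Fintype.card A := by
    by_contra hlt
    have hsub : (A : Set (EuclideanSpace ℝ (Fin (d + 1)))).Subsingleton := by
      rw [Fintype.card_coe] at hlt
      exact Finset.card_le_one_iff_subsingleton.1 (by omega)
    have h2 : (cell a Finset.univ).Subsingleton := by
      rw [cell_eq_convexHull, Finset.coe_univ, Set.image_univ, Subtype.range_coe_subtype]
      rcases hsub.eq_empty_or_singleton with h | ⟨x, h⟩
      · simp [h]
      · simp [h]
    obtain ⟨x, hx⟩ := hint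
    rw [h2.eq_singleton_of_mem (interior_subset hx), interior_singleton] at hx
    exact hx
  have hTpos : 2 ≤ T := le_trans (by exact_mod_cast hcardA) hcardT
  have hSZ : ∀ z ∈ hWfin.toFinset, z ∈ integerLattice (d + 1) := fun z hz =>
    ((Set.Finite.mem_toFinset _).1 hz).2
  have hSP : ∀ z ∈ hWfin.toFinset, z ∈ cell a Finset.univ := fun z hz =>
    hWP z ((Set.Finite.mem_toFinset _).1 hz)
  rw [hcount, Nat.add_sub_cancel, mul_assoc]
  rcases Nat.eq_zero_or_pos d with rfl | hd
  · have h1 := card_le_volume_add_one (isCompact_cell a _) (convex_cell a _) _ hSZ hSP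
    have h2 : (Real.sqrt ((0 + 1 : ℕ) : ℝ) + 1) / 2 = 1 := by norm_num
    rw [h2, one_mul]
    linarith
  · have h1 := card_le_volume_add_facetWeight hd hg hint Subtype.val_injective hext hZ _ hSZ hSP
    rw [← hT] at h1
    -- `1 + x / 8 < (x + 1) / 2` means `x > 4 / 3`, and `16 / 9 < 2 ≤ d + 1`.
    have hs : (4 / 3 : ℝ) < Real.sqrt ((d + 1 : ℕ) : ℝ) := by
      refine Real.lt_sqrt_of_sq_lt ?_
      have : (2 : ℝ) ≤ ((d + 1 : ℕ) : ℝ) := by exact_mod_cast Nat.succ_le_succ hd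
      linarith
    have h2 : (1 + Real.sqrt ((d + 1 : ℕ) : ℝ) / 8) * T <
        (Real.sqrt ((d + 1 : ℕ) : ℝ) + 1) / 2 * T :=
      mul_lt_mul_of_pos_right (by linarith) (by linarith)
    have h3 : (Real.sqrt ((d + 1 : ℕ) : ℝ) + 1) / 2 * T ≤
        (Real.sqrt ((d + 1 : ℕ) : ℝ) + 1) / 2 * ((d.factorial : ℝ) * surfaceArea K) :=
      mul_le_mul_of_nonneg_left harea (by positivity)
    linarith
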